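/- Let $d,s\in\mathbb N$ with $s\ge 1$ (physically $d\in\{1,2\}$), $T>0$, $g\in\mathbb R$, $I=(0,1)$ and $\tilde\Omega=\mathbb R^d\times I$. Write $C^s_b$ for the space of $C^s$ functions all of whose derivatives up to order $s$ are continuous and bounded. Let $z_b\in C_b^s(\mathbb R^d)$, and let $(\eta,\mathbf u,w)$ be a classical solution, with initial data $(\eta_0,\mathbf u_0)$, of the free-surface hydrostatic Euler system with zero atmospheric pressure, $$\partial_t\eta+\mathbf u|_{z=\eta}\cdot\nabla_x\eta-w|_{z=\eta}=0,\qquad \mathbf u|_{z=z_b}\cdot\nabla_x z_b-w|_{z=z_b}=0\qquad\text{in }(0,T)\times\mathbb R^d,$$ $$\partial_t\mathbf u+\mathbf u\cdot\nabla_x\mathbf u+w\,\partial_z\mathbf u+g\nabla_x\eta=0,\qquad \nabla_x\cdot\mathbf u+\partial_z w=0\qquad\text{in }\mathcal D_T=\{(t,x,z):0<t<T,\ (x,z)\in\Omega_t\},$$ where $\Omega_t=\{(x,z)\in\mathbb R^d\times\mathbb R: z_b(x)<z<\eta(t,x)\}$, with positive depth $\eta(t,x)>z_b(x)$ for all $t\in(0,T)$,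 $x\in\mathbb R^d$. The values of $\mathbf u,w$ on the bottom and the surface are those of their continuous extensions, and the initial data are attained continuously. Assume that $\eta\in C_b^s((0,T)\times\mathbb R^d)$, $\mathbf u\in C_b^s(\mathcal D_T)^d$ and $w\in C_b^s(\mathcal D_T)$. Let either (a) $D_t=\Omega_t$ for all $t\in[0,T)$ and $(\mathbf U,W)=(\mathbf u,w)$ on $\mathcal D_T$, or (b) $D_t=\mathbb R^{d+1}$ for all $t\in[0,T)$ and $(\mathbf U,W)$ be any extension of $(\mathbf u,w)$ from $\mathcal D_T$ to a field in $C_b^s((0,T)\times\mathbb R^{d+1})^{d+1}$. Let $\phi_0\in C_b^s(\tilde\Omega)$ be such that $(x,\phi_0(x,\lambda))\in D_0$ for all $(x,\lambda)\in\tilde\Omega$ (no condition in case (b)). Then there is $T^*\in(0,T]$ such that the problem $$\partial_t\phi+\mathbf U(t,x,\phi)\cdot\nabla_x\phi=W(t,x,\phi)\ \text{ in }(0,T^*)\times\tilde\Omega,\qquad \phi(0,x,\lambda)=\phi_0(x,\lambda)\ \text{ in }\tilde\Omega,$$ has exactly one solution $\phi\in C^s((0,T^*)\times\tilde\Omega)$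 that is continuous on $[0,T^*)\times\tilde\Omega$ and satisfies $(x,\phi(t,x,\lambda))\in D_t$ for all $t\in(0,T^*)$, $(x,\lambda)\in\tilde\Omega$. Moreover, if $\inf_{\tilde\Omega}\partial_\lambda\phi_0>0$, then $\partial_\lambda\phi(t,x,\lambda)>0$ for all $t\in(0,T^*)$ and $(x,\lambda)\in\tilde\Omega$. If in addition $\phi_0(x,0)=z_b(x)$ and $\phi_0(x,1)=\eta_0(x)$ for all $x$ (in the sense of limits as $\lambda\to0^+$ and $\lambda\to1^-$), then for every $t\in(0,T^*)$ the map $(x,\lambda)\mapsto(x,\phi(t,x,\lambda))$ is an orientation-preserving $C^s$ diffeomorphism from $\tilde\Omega$ onto $\Omega_t$. -/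

import Mathlib

namespace HydrostaticEuler

open Set

/-- Functions of class `C_b^s` on an open set `S`: all derivatives up to order `s` exist, are
continuous and are bounded on `S`. -/
def CbOn {V W : Type*} [NormedAddCommGroup V] [NormedSpace ℝ V] [NormedAddCommGroup W]
    [NormedSpace ℝ W] (s : ℕ) (f : V → W) (S : Set V) : Prop :=
  ContDiffOn ℝ s f S ∧
    ∃ C : ℝ, ∀ k : ℕ, k ≤ s → ∀ p ∈ S, ‖iteratedFDerivWithin ℝ k f S p‖ ≤ C

/-- Horizontal space `ℝ^d`. -/
abbrev Horiz (d : ℕ) : Type := EuclideanSpace ℝ (Fin d)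

/-- The reference domain `ℝ^d × (0, 1)`. -/
def strip (d : ℕ) : Set (Horiz d × ℝ) := univ ×ˢ Ioo (0 : ℝ) 1

/-- The fluid domain `Ω_t = {(x, z) : z_b(x) < z < η(t, x)}`. -/
def fluidDomain {d : ℕ} (zb : Horiz d → ℝ) (η : ℝ → Horiz d → ℝ) (t : ℝ) : Set (Horiz d × ℝ) :=
  {p | zb p.1 < p.2 ∧ p.2 < η t p.1}

/-- The fluid domain together with bottom and surface: `z_b(x) ≤ z ≤ η(t, x)`. -/
def closedFluidDomain {d : ℕ} (zb : Horiz d → ℝ) (η : ℝ → Horiz d → ℝ) (t : ℝ) :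
    Set (Horiz d × ℝ) :=
  {p | zb p.1 ≤ p.2 ∧ p.2 ≤ η t p.1}

/-- The space-time set `{(t, x, z) : t ∈ J, (x, z) ∈ D_t}`. -/
def spaceTime {d : ℕ} (J : Set ℝ) (D : ℝ → Set (Horiz d × ℝ)) : Set (ℝ × Horiz d × ℝ) :=
  {q | q.1 ∈ J ∧ q.2 ∈ D q.1}

/-- A function of `(t, x, z)` seen as a function on the product. -/
def joint {d : ℕ} {V : Type*} (f : ℝ → Horiz d → ℝ → V) : ℝ × Horiz d × ℝ → V :=
  fun q => f q.1 q.2.1 q.2.2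

/-- Classical solution of the free-surface hydrostatic Euler system on `(0, T)` with bottom `zb`,
gravity constant `g`, no atmospheric pressure, and initial data `(η₀, u₀)`. The values of `u` and
`w` on the bottom and on the surface are those of their continuous extension, and the initial
conditions are attained continuously. -/
structure IsSolution {d : ℕ} (g T : ℝ) (zb : Horiz d → ℝ) (η₀ : Horiz d → ℝ)
    (u₀ : Horiz d → ℝ → Horiz d) (η : ℝ → Horiz d → ℝ) (u : ℝ → Horiz d → ℝ → Horiz d)
    (w : ℝ → Horiz d → ℝ → ℝ) : Prop where
  continuousOn_u : ContinuousOn (joint u) (spaceTime (Ioo 0 T) (closedFluidDomain zb η))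
  continuousOn_w : ContinuousOn (joint w) (spaceTime (Ioo 0 T) (closedFluidDomain zb η))
  surface : ∀ t ∈ Ioo 0 T, ∀ x,
    deriv (fun τ => η τ x) t + fderiv ℝ (η t) x (u t x (η t x)) - w t x (η t x) = 0
  bottom : ∀ t ∈ Ioo 0 T, ∀ x, fderiv ℝ zb x (u t x (zb x)) - w t x (zb x) = 0
  momentum : ∀ t ∈ Ioo 0 T, ∀ x z, (x, z) ∈ fluidDomain zb η t →
    deriv (fun τ => u τ x z) t + fderiv ℝ (fun y => u t y z) x (u t x z)
      + w t x z • deriv (fun ζ => u t x ζ) z + g • gradient (η t) x = 0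
  incompressible : ∀ t ∈ Ioo 0 T, ∀ x z, (x, z) ∈ fluidDomain zb η t →
    (∑ i : Fin d, fderiv ℝ (fun y => u t y z) x (EuclideanSpace.single i 1) i)
      + deriv (fun ζ => w t x ζ) z = 0
  initial_u : ∀ x z, (x, z) ∈ fluidDomain zb η 0 → u 0 x z = u₀ x z
  initial_u_continuousOn : ContinuousOn (joint u) (spaceTime (Ico 0 T) (fluidDomain zb η))
  initial_η : ∀ x, η 0 x = η₀ x
  initial_η_continuousOn :
    ContinuousOn (fun q : ℝ × Horiz d => η q.1 q.2) (Ico 0 T ×ˢ univ)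

/-- `φ` is a solution of class `C^s` on `(0, T') × ℝ^d × (0, 1)` of
`∂_t φ + U(t, x, φ) · ∇_x φ = W(t, x, φ)`, `φ(0, ·) = φ₀`, for fields `U(t, ·)`, `W(t, ·)` defined
on `D t`. The initial condition is attained continuously. -/
structure IsTransportSolution {d : ℕ} (s : ℕ) (T' : ℝ) (D : ℝ → Set (Horiz d × ℝ))
    (U : ℝ → Horiz d → ℝ → Horiz d) (W : ℝ → Horiz d → ℝ → ℝ) (φ₀ : Horiz d → ℝ → ℝ)
    (φ : ℝ → Horiz d → ℝ → ℝ) : Prop where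
  contDiffOn : ContDiffOn ℝ s (joint φ) (Ioo 0 T' ×ˢ strip d)
  mem_domain : ∀ t ∈ Ioo 0 T', ∀ x, ∀ l ∈ Ioo (0 : ℝ) 1, (x, φ t x l) ∈ D t
  equation : ∀ t ∈ Ioo 0 T', ∀ x, ∀ l ∈ Ioo (0 : ℝ) 1,
    deriv (fun τ => φ τ x l) t + fderiv ℝ (fun y => φ t y l) x (U t x (φ t x l))
      = W t x (φ t x l)
  initial : ∀ x, ∀ l ∈ Ioo (0 : ℝ) 1, φ 0 x l = φ₀ x l
  initial_continuousOn : ContinuousOn (joint φ) (Ico 0 T' ×ˢ strip d)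

/-- `F` restricts to an orientation-preserving `C^s` diffeomorphism between the open sets `A` and
`B`. -/
def IsOrientedDiffeoOn {V : Type*} [NormedAddCommGroup V] [NormedSpace ℝ V] (s : ℕ) (F : V → V)
    (A B : Set V) : Prop :=
  BijOn F A B ∧ ContDiffOn ℝ s F A ∧ (∃ G : V → V, InvOn G F A B ∧ ContDiffOn ℝ s G B) ∧
    ∀ p ∈ A, 0 < (fderiv ℝ F p).det

end HydrostaticEuler

open Set Filter Topology MeasureTheory
open scoped NNReal

namespace HydrostaticEuler

/-! The proof is the method of characteristics on a short time interval. The fields `(U, W)` are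
Lipschitz on the space-time domain. In case (a) this domain need not be convex, and two points are
joined by moving along an interpolated graph between bottom and surface and then vertically
(`lipschitzOnWith_between_graphs`). Hence `(U, W)` extends to a Lipschitz field `F` on all of
space-time, with some constant `K`. Its integral curves exist on the whole of `[0, T']` once `K * T'
≤ 1 / 2`, and the difference of two of them changes at most by the factor `2 * K * T'`.

Let `χ (t, x, l)` be the curve issuing from `(x, φ₀ x l)`, and let `L` be the Lipschitz constant of
`φ₀`. If `2 * K * T' * (1 + L) ≤ 1 / 2`, the horizontal displacement of `χ` is a `1 / 2`-contraction
in `x`, so the horizontal component of `χ (t, ·, l)` is a bijection of `ℝ^d`. The solution is the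
vertical component of `χ` composed with the inverse of this bijection (`exists_isCarried`). Its
regularity follows from the inverse function theorem and from `C^s` dependence of the flow on its
data. The latter needs an argument of its own (`IsLocalFlow.contDiffOn`), because `F` is
differentiable only at positive times, with derivatives bounded down to `t = 0`.

Uniqueness is a Gronwall argument along a characteristic traced back from a point of the graph of
another solution. Monotonicity in `l` survives because two characteristics that meet the same
vertical line at time `t` start from almost the same vertical line, so increments in `l` shrink at
most by a factor two.

For the diffeomorphism, the kinematic conditions say that `F` is tangent to bottom and surface. By
uniqueness no integral curve crosses them, forward or backward (`IsTrajectory.mem_fluidDomain_iff`).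
Each point of `Ω_t` thus traces back into `Ω_0`, where the graphs of `φ₀ (·, l)` fill the whole
water column. -/

/-- Terms of the Peano–Baker series solving `M' = A M`, `M 0 = 1`. -/
noncomputable def peanoBaker {P X : Type*} [NormedRing X] [NormedAlgebra ℝ X]
    (A : ℝ → P → X) : ℕ → ℝ → P → X
  | 0 => fun _ _ => 1
  | n + 1 => fun t p => ∫ τ in (0 : ℝ)..t, A τ p * peanoBaker A n τ p

/-! ### Linear differential equations with a parameter -/

section LinearODE

variable {P X : Type*} [TopologicalSpace P] [FirstCountableTopology P]
  [NormedRing X] [NormedAlgebra ℝ X]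

theorem continuous_parametric_primitive_of_bounded {f : ℝ → P → X} {C : ℝ → ℝ}
    (hC : Continuous C)
    (hmeas : ∀ p, AEStronglyMeasurable (fun t => f t p))
    (hcont : ∀ t, Continuous (f t)) (hbound : ∀ t p, ‖f t p‖ ≤ C t) :
    Continuous fun q : ℝ × P => ∫ τ in (0 : ℝ)..q.1, f τ q.2 := by
  rw [continuous_iff_continuousAt]
  rintro ⟨t, p⟩
  have h := intervalIntegral.continuousAt_parametric_primitive_of_dominated
    (μ := volume) (F := fun p τ => f τ p) C (-|t| - 1) (|t| + 1)
    (a₀ := 0) (b₀ := t) (x₀ := p) (fun x => (hmeas x).restrict)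
    (Eventually.of_forall fun x => Eventually.of_forall fun τ => hbound τ x)
    (hC.intervalIntegrable _ _)
    (Eventually.of_forall fun τ => (hcont τ).continuousAt)
    (by constructor <;> linarith [abs_nonneg t])
    (by constructor <;> linarith [neg_abs_le t, le_abs_self t]) (by simp)
  exact h.comp (f := fun q : ℝ × P => (q.2, q.1)) (x := (t, p)) continuous_swap.continuousAt

/-- Integrating the bound for one term, multiplied by `L`, gives exactly the bound for the next, so
the series is dominated by that of `exp (L * |t|)`. -/
theorem peanoBaker_spec {A : ℝ → P → X} {L : ℝ}
    (hmeas : ∀ p, AEStronglyMeasurable (fun t => A t p))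
    (hcont : ∀ t, Continuous (A t)) (hbound : ∀ t p, ‖A t p‖ ≤ L) (n : ℕ) :
    Continuous (fun q : ℝ × P => peanoBaker A n q.1 q.2) ∧
      ∀ t p, ‖peanoBaker A n t p‖ ≤ ‖(1 : X)‖ * ((L * |t|) ^ n / n.factorial) := by
  induction n with
  | zero => exact ⟨continuous_const, fun t p => by simp [peanoBaker]⟩
  | succ n ih =>
    obtain ⟨ihc, ihb⟩ := ih
    have hb : ∀ t p, ‖A t p * peanoBaker A n t p‖ ≤
        L * (‖(1 : X)‖ * ((L * |t|) ^ n / n.factorial)) := fun t p =>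
      (norm_mul_le _ _).trans
        (mul_le_mul (hbound t p) (ihb t p) (norm_nonneg _) ((norm_nonneg _).trans (hbound t p)))
    constructor
    · refine continuous_parametric_primitive_of_bounded
        (C := fun t => L * (‖(1 : X)‖ * ((L * |t|) ^ n / n.factorial))) (by fun_prop)
        (fun p => (hmeas p).mul ?_) (fun t => (hcont t).mul ?_) hb
      · exact (ihc.comp (by fun_prop : Continuous fun t : ℝ => (t, p))).aestronglyMeasurable
      · exact ihc.comp (by fun_prop : Continuous fun p : P => (t, p))
    · intro t p
      have hder : ∀ x : ℝ, HasDerivAt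
          (fun τ : ℝ => ‖(1 : X)‖ * ((L * τ) ^ (n + 1) / (n + 1).factorial))
          (L * (‖(1 : X)‖ * ((L * x) ^ n / n.factorial))) x := by
        intro x
        have h1 := ((((hasDerivAt_id x).const_mul L).pow (n + 1)).div_const
          ((n + 1).factorial : ℝ)).const_mul ‖(1 : X)‖
        refine h1.congr_deriv ?_
        have : (n.factorial : ℝ) ≠ 0 := by positivity
        rw [Nat.factorial_succ]
        push_cast
        simp only [id, mul_one]
        field_simp
      have hint : ∀ a : ℝ, ∫ x in (0 : ℝ)..a, L * (‖(1 : X)‖ * ((L * x) ^ n / n.factorial)) =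
          ‖(1 : X)‖ * ((L * a) ^ (n + 1) / (n + 1).factorial) := by
        intro a
        rw [intervalIntegral.integral_eq_sub_of_hasDerivAt (fun x _ => hder x)
          (Continuous.intervalIntegrable (by fun_prop) _ _)]
        simp
      simp only [peanoBaker]
      rcases le_total 0 t with ht | ht
      · rw [abs_of_nonneg ht, ← hint t]
        refine intervalIntegral.norm_integral_le_of_norm_le ht
          (Eventually.of_forall fun τ hτ => ?_) (Continuous.intervalIntegrable (by fun_prop) _ _)
        simpa [abs_of_pos hτ.1] using hb τ p
      · rw [abs_of_nonpos ht, ← hint (-t), intervalIntegral.integral_symm, norm_neg]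
        have := intervalIntegral.integral_comp_neg (a := t) (b := 0)
          (fun x => L * (‖(1 : X)‖ * ((L * x) ^ n / n.factorial)))
        rw [neg_zero] at this
        rw [← this]
        refine intervalIntegral.norm_integral_le_of_norm_le ht
          (Eventually.of_forall fun τ hτ => ?_) (Continuous.intervalIntegrable (by fun_prop) _ _)
        simpa [abs_of_nonpos hτ.2] using hb τ p

/-- Linear differential equations with bounded coefficients that depend continuously on a
parameter have a fundamental solution that is jointly continuous in time and the parameter. -/
theorem exists_fundamental_solution [CompleteSpace X] {A : ℝ → P → X} {L : ℝ}
    (hmeas : ∀ p, AEStronglyMeasurable (fun t => A t p))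
    (hcont : ∀ t, Continuous (A t)) (hbound : ∀ t p, ‖A t p‖ ≤ L) :
    ∃ M : ℝ → P → X, Continuous (fun q : ℝ × P => M q.1 q.2) ∧
      ∀ t p, M t p = 1 + ∫ τ in (0 : ℝ)..t, A τ p * M τ p := by
  have hspec := peanoBaker_spec hmeas hcont hbound
  have hsum : ∀ R : ℝ, Summable fun n : ℕ => ‖(1 : X)‖ * ((L * R) ^ n / n.factorial) :=
    fun R => (Real.summable_pow_div_factorial _).mul_left _
  have hle : ∀ (n : ℕ) (t R : ℝ) (p : P), |t| ≤ R →
      ‖peanoBaker A n t p‖ ≤ ‖(1 : X)‖ * ((L * R) ^ n / n.factorial) := by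
    intro n t R p h
    have hL : 0 ≤ L := (norm_nonneg _).trans (hbound t p)
    refine ((hspec n).2 t p).trans ?_
    gcongr
  refine ⟨fun t p => ∑' n, peanoBaker A n t p, ?_, ?_⟩
  · rw [continuous_iff_continuousAt]
    rintro ⟨t, p⟩
    have hopen : IsOpen {q : ℝ × P | |q.1| < |t| + 1} :=
      isOpen_lt (by fun_prop) continuous_const
    have : ContinuousOn (fun q : ℝ × P => ∑' n, peanoBaker A n q.1 q.2)
        {q : ℝ × P | |q.1| < |t| + 1} :=
      continuousOn_tsum (fun n => (hspec n).1.continuousOn) (hsum (|t| + 1))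
        (fun n q hq => hle n q.1 _ q.2 (le_of_lt hq))
    exact this.continuousAt (hopen.mem_nhds (by simp))
  · intro t p
    have hs : Summable fun n => peanoBaker A n t p :=
      Summable.of_norm_bounded (hsum |t|) fun n => hle n t _ p le_rfl
    -- The zeroth term is the `1`; what remains is to integrate the series term by term, by
    -- dominated convergence.
    simp only [hs.tsum_eq_zero_add]
    congr 1
    have hL : 0 ≤ L := (norm_nonneg _).trans (hbound t p)
    have h := intervalIntegral.hasSum_integral_of_dominated_convergence (μ := volume)
      (a := 0) (b := t) (F := fun n τ => A τ p * peanoBaker A n τ p)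
      (f := fun τ => A τ p * ∑' n, peanoBaker A n τ p)
      (fun n _ => L * (‖(1 : X)‖ * ((L * |t|) ^ n / n.factorial)))
      (fun n => ((hmeas p).mul
        ((hspec n).1.comp (by fun_prop : Continuous fun t : ℝ => (t, p))).aestronglyMeasurable).restrict)
      (fun n => Eventually.of_forall fun τ hτ => by
        have hτt : |τ| ≤ |t| := by
          rcases le_total 0 t with ht | ht
          · rw [uIoc_of_le ht] at hτ
            rw [abs_of_pos hτ.1, abs_of_nonneg ht]; exact hτ.2
          · rw [uIoc_of_ge ht] at hτ
            rw [abs_of_nonpos hτ.2, abs_of_nonpos ht]; linarith [hτ.1]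
        exact (norm_mul_le _ _).trans
          (mul_le_mul (hbound τ p) (hle n τ _ p hτt) (norm_nonneg _) hL))
      (Eventually.of_forall fun τ _ => (hsum |t|).mul_left L)
      (by simp)
      (Eventually.of_forall fun τ _ => by
        have : Summable fun n => peanoBaker A n τ p :=
          Summable.of_norm_bounded (hsum |τ|) fun n => hle n τ _ p le_rfl
        exact this.hasSum.mul_left _)
    exact h.tsum_eq

end LinearODE

/-! ### Increments of a local flow -/

section Flow

variable {E : Type*} [NormedAddCommGroup E] [NormedSpace ℝ E]

/-- Gronwall's inequality from a time `ε > a`, then `ε → a`. The derivative is needed only in the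
open interval, as the fields are not assumed differentiable, nor the equation to hold, at the
initial time. -/
theorem eq_zero_of_norm_deriv_le_mul_norm {f f' : ℝ → E} {a b K : ℝ} (hab : a ≤ b)
    (hc : ContinuousOn f (Icc a b)) (hd : ∀ t ∈ Ioo a b, HasDerivAt f (f' t) t)
    (hK : ∀ t ∈ Ioo a b, ‖f' t‖ ≤ K * ‖f t‖) (ha : f a = 0) : f b = 0 := by
  rcases hab.eq_or_lt with rfl | hab
  · exact ha
  have hle : ∀ ε ∈ Ioo a b, ‖f b‖ ≤ ‖f ε‖ * Real.exp (K * (b - ε)) := by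
    intro ε hε
    have := norm_le_gronwallBound_of_norm_deriv_right_le (f := f) (f' := f') (δ := ‖f ε‖) (K := K)
      (ε := 0) (a := ε) (b := b) (hc.mono (Icc_subset_Icc_left hε.1.le))
      (fun x hx => (hd x ⟨hε.1.trans_le hx.1, hx.2⟩).hasDerivWithinAt) le_rfl
      (fun x hx => by simpa using hK x ⟨hε.1.trans_le hx.1, hx.2⟩) b ⟨hε.2.le, le_rfl⟩
    rwa [gronwallBound_ε0] at this
  have h1 : Tendsto f (𝓝[>] a) (𝓝 0) := by
    have := (hc a ⟨le_rfl, hab.le⟩).mono_left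
      (nhdsWithin_mono a (Ioo_subset_Icc_self : Ioo a b ⊆ Icc a b))
    rwa [nhdsWithin_Ioo_eq_nhdsGT hab, ha] at this
  have h2 : Tendsto (fun ε => Real.exp (K * (b - ε))) (𝓝[>] a) (𝓝 (Real.exp (K * (b - a)))) :=
    (Continuous.tendsto (by fun_prop) a).mono_left nhdsWithin_le_nhds
  have h3 := h1.norm.mul h2
  rw [norm_zero, zero_mul] at h3
  have h4 : ‖f b‖ ≤ 0 := ge_of_tendsto h3 (by
    filter_upwards [Ioo_mem_nhdsGT hab] with ε hε using hle ε hε)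
  exact norm_le_zero_iff.1 h4

/-- `Γ(t, y)` is the value at time `t < T` of the integral curve of `F` that starts in `y ∈ V` at
time `0`; the curves stay in `O`. For negative times the flow is stationary by convention. -/
structure IsLocalFlow (T : ℝ) (O : Set (ℝ × E)) (F : ℝ × E → E) (V : Set E) (Γ : ℝ × E → E) :
    Prop where
  continuousOn : ContinuousOn Γ (Iio T ×ˢ V)
  mem : ∀ t < T, ∀ y ∈ V, (t, Γ (t, y)) ∈ O
  initial : ∀ t ≤ 0, ∀ y ∈ V, Γ (t, y) = y
  hasDerivAt : ∀ t ∈ Ioo 0 T, ∀ y ∈ V, HasDerivAt (fun τ => Γ (τ, y)) (F (t, Γ (t, y))) t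

/-- The part of `O` at times in `(0, T)`. -/
def posPart (T : ℝ) (O : Set (ℝ × E)) : Set (ℝ × E) := O ∩ Ioo 0 T ×ˢ univ

omit [NormedSpace ℝ E] in
theorem isOpen_posPart {T : ℝ} {O : Set (ℝ × E)} (hO : IsOpen O) : IsOpen (posPart T O) :=
  hO.inter (isOpen_Ioo.prod isOpen_univ)

/-- The mean of the spatial derivative of `F (t, ·)` over the segment from `x` to `x'`. -/
noncomputable def segmentMean (F : ℝ × E → E) (t : ℝ) (x x' : E) : E →L[ℝ] E :=
  ∫ θ in (0 : ℝ)..1, (fderiv ℝ F (t, x + θ • (x' - x))).comp (ContinuousLinearMap.inr ℝ ℝ E)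

theorem segmentMean_self [CompleteSpace E] (F : ℝ × E → E) (t : ℝ) (x : E) :
    segmentMean F t x x = (fderiv ℝ F (t, x)).comp (ContinuousLinearMap.inr ℝ ℝ E) := by
  simp [segmentMean]

theorem norm_comp_inr_le (A : ℝ × E →L[ℝ] E) : ‖A.comp (ContinuousLinearMap.inr ℝ ℝ E)‖ ≤ ‖A‖ :=
  ContinuousLinearMap.opNorm_le_bound _ (norm_nonneg _) fun v => by
    refine (A.le_opNorm _).trans_eq ?_
    simp

theorem norm_segmentMean_le {F : ℝ × E → E} {t C : ℝ} {x x' : E}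
    (h : ∀ θ ∈ Icc (0 : ℝ) 1, ‖fderiv ℝ F (t, x + θ • (x' - x))‖ ≤ C) :
    ‖segmentMean F t x x'‖ ≤ C := by
  have := intervalIntegral.norm_integral_le_of_norm_le_const (a := 0) (b := 1) (C := C)
    (f := fun θ : ℝ => (fderiv ℝ F (t, x + θ • (x' - x))).comp (ContinuousLinearMap.inr ℝ ℝ E))
    (fun θ hθ => by
      rw [uIoc_of_le zero_le_one] at hθ
      exact (norm_comp_inr_le _).trans (h θ ⟨hθ.1.le, hθ.2⟩))
  simpa [segmentMean] using this

/-- The fundamental theorem of calculus along the segment. It turns the equation for the difference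
of two integral curves into a linear one. -/
theorem segmentMean_apply_sub [CompleteSpace E] {F : ℝ × E → E} {S : Set (ℝ × E)} {t : ℝ} {x x' : E}
    (hd : ∀ p ∈ S, DifferentiableAt ℝ F p) (hc : ContinuousOn (fderiv ℝ F) S)
    (h : ∀ θ ∈ Icc (0 : ℝ) 1, (t, x + θ • (x' - x)) ∈ S) :
    segmentMean F t x x' (x' - x) = F (t, x') - F (t, x) := by
  have hline : Continuous fun θ : ℝ => (t, x + θ • (x' - x)) := by fun_prop
  have hcont : ContinuousOn (fun θ : ℝ =>
      (fderiv ℝ F (t, x + θ • (x' - x))).comp (ContinuousLinearMap.inr ℝ ℝ E)) (Icc 0 1) :=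
    (hc.comp hline.continuousOn h).clm_comp continuousOn_const
  have hint := hcont.intervalIntegrable_of_Icc (μ := volume) zero_le_one
  rw [segmentMean, ContinuousLinearMap.intervalIntegral_apply hint]
  have := intervalIntegral.integral_eq_sub_of_hasDerivAt (a := 0) (b := 1)
    (f := fun θ : ℝ => F (t, x + θ • (x' - x)))
    (f' := fun θ : ℝ => ((fderiv ℝ F (t, x + θ • (x' - x))).comp
      (ContinuousLinearMap.inr ℝ ℝ E)) (x' - x)) (fun θ hθ => by
        rw [uIcc_of_le zero_le_one] at hθ
        have h1 : HasDerivAt (fun θ : ℝ => (t, x + θ • (x' - x))) ((0 : ℝ), x' - x) θ := by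
          refine (hasDerivAt_const θ t).prodMk ?_
          simpa using ((hasDerivAt_id θ).smul_const (x' - x)).const_add x
        exact (hd _ (h θ hθ)).hasFDerivAt.comp_hasDerivAt θ h1)
    ((hcont.clm_apply continuousOn_const).intervalIntegrable_of_Icc zero_le_one)
  simpa using this

theorem continuousAt_segmentMean {Q : Type*} [TopologicalSpace Q] [FirstCountableTopology Q]
    {F : ℝ × E → E} {S : Set (ℝ × E)} {C : ℝ} (hS : IsOpen S)
    (hc : ContinuousOn (fderiv ℝ F) S) {t : Q → ℝ} {x x' : Q → E} {q₀ : Q}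
    (ht : ContinuousAt t q₀) (hx : ContinuousAt x q₀) (hx' : ContinuousAt x' q₀)
    (h : ∀ᶠ q in 𝓝 q₀, ∀ θ ∈ Icc (0 : ℝ) 1, (t q, x q + θ • (x' q - x q)) ∈ S ∧
      ‖fderiv ℝ F (t q, x q + θ • (x' q - x q))‖ ≤ C) :
    ContinuousAt (fun q => segmentMean F (t q) (x q) (x' q)) q₀ := by
  unfold segmentMean
  refine intervalIntegral.continuousAt_of_dominated_interval (bound := fun _ => C) ?_ ?_
    (by simp) ?_
  · filter_upwards [h] with q hq
    have hline : Continuous fun θ : ℝ => (t q, x q + θ • (x' q - x q)) := by fun_prop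
    have hcont : ContinuousOn (fun θ : ℝ => (fderiv ℝ F (t q, x q + θ • (x' q - x q))).comp
        (ContinuousLinearMap.inr ℝ ℝ E)) (Icc 0 1) :=
      (hc.comp hline.continuousOn fun θ hθ => (hq θ hθ).1).clm_comp continuousOn_const
    rw [uIoc_of_le zero_le_one]
    exact (hcont.mono Ioc_subset_Icc_self).aestronglyMeasurable measurableSet_Ioc
  · filter_upwards [h] with q hq
    refine Eventually.of_forall fun θ hθ => ?_
    rw [uIoc_of_le zero_le_one] at hθ
    exact (norm_comp_inr_le _).trans (hq θ ⟨hθ.1.le, hθ.2⟩).2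
  · refine Eventually.of_forall fun θ hθ => ?_
    rw [uIoc_of_le zero_le_one] at hθ
    have hmem := (h.self_of_nhds θ ⟨hθ.1.le, hθ.2⟩).1
    have h1 : ContinuousAt (fderiv ℝ F) (t q₀, x q₀ + θ • (x' q₀ - x q₀)) :=
      hc.continuousAt (hS.mem_nhds hmem)
    have h2 : ContinuousAt (fun q => (t q, x q + θ • (x' q - x q))) q₀ := by fun_prop
    exact (ContinuousAt.comp (f := fun q => (t q, x q + θ • (x' q - x q))) h1 h2).clm_comp
      continuousAt_const

/-- Near a compact piece of an integral curve, segments between integral curves stay in the domain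
and are bounded. -/
theorem IsLocalFlow.exists_ball_segment_mem {T : ℝ} {O : Set (ℝ × E)} {F : ℝ × E → E} {V : Set E}
    {Γ : ℝ × E → E} (hΓ : IsLocalFlow T O F V Γ) (hO : IsOpen O) (hV : IsOpen V) {y₀ : E}
    (hy₀ : y₀ ∈ V) {t₁ : ℝ} (ht₁ : t₁ < T) :
    ∃ r > 0, ∃ R : ℝ, Metric.ball y₀ r ⊆ V ∧ ∀ y ∈ Metric.ball y₀ r, ∀ y' ∈ Metric.ball y₀ r,
      ∀ t ∈ Icc 0 t₁, ∀ θ ∈ Icc (0 : ℝ) 1,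
        (t, Γ (t, y) + θ • (Γ (t, y') - Γ (t, y))) ∈ O ∧
          ‖(t, Γ (t, y) + θ • (Γ (t, y') - Γ (t, y)))‖ ≤ R := by
  have hcont : ∀ t < T, ∀ y ∈ V, ContinuousAt Γ (t, y) := fun t ht y hy =>
    hΓ.continuousOn.continuousAt ((isOpen_Iio.prod hV).mem_nhds ⟨ht, hy⟩)
  have hcurve : ContinuousOn (fun t => (t, Γ (t, y₀))) (Icc 0 t₁) := fun t ht =>
    (continuousAt_id.prodMk ((hcont t (ht.2.trans_lt ht₁) y₀ hy₀).comp
      (f := fun t => (t, y₀)) (by fun_prop))).continuousWithinAt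
  obtain ⟨R, hR⟩ := isCompact_Icc.exists_bound_of_continuousOn hcurve
  -- Tube argument: at `z = (y₀, y₀)` the segment degenerates to a point of the curve, which lies in
  -- an open set; compactness in time and `θ` makes one neighbourhood of `(y₀, y₀)` serve for all.
  have key : ∀ᶠ z : E × E in 𝓝 (y₀, y₀), ∀ q ∈ Icc 0 t₁ ×ˢ Icc (0 : ℝ) 1,
      (q.1, Γ (q.1, z.1) + q.2 • (Γ (q.1, z.2) - Γ (q.1, z.1))) ∈ O ∩ Metric.ball 0 (R + 1) := by
    refine (isCompact_Icc.prod isCompact_Icc).eventually_forall_of_forall_eventually ?_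
    rintro ⟨t, θ⟩ ⟨ht, hθ⟩
    have htT : t < T := ht.2.trans_lt ht₁
    have hopen : IsOpen (O ∩ Metric.ball 0 (R + 1)) := hO.inter Metric.isOpen_ball
    have h1 : ContinuousAt (fun w : (E × E) × (ℝ × ℝ) => Γ (w.2.1, w.1.1)) ((y₀, y₀), (t, θ)) :=
      (hcont t htT y₀ hy₀).comp (f := fun w : (E × E) × (ℝ × ℝ) => (w.2.1, w.1.1))
        (x := ((y₀, y₀), (t, θ))) (by fun_prop)
    have h2 : ContinuousAt (fun w : (E × E) × (ℝ × ℝ) => Γ (w.2.1, w.1.2)) ((y₀, y₀), (t, θ)) :=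
      (hcont t htT y₀ hy₀).comp (f := fun w : (E × E) × (ℝ × ℝ) => (w.2.1, w.1.2))
        (x := ((y₀, y₀), (t, θ))) (by fun_prop)
    have h3 : ContinuousAt (fun w : (E × E) × (ℝ × ℝ) =>
        (w.2.1, Γ (w.2.1, w.1.1) + w.2.2 • (Γ (w.2.1, w.1.2) - Γ (w.2.1, w.1.1))))
        ((y₀, y₀), (t, θ)) := by fun_prop
    refine h3.eventually_mem (hopen.mem_nhds ?_)
    simp only [sub_self, smul_zero, add_zero]
    exact ⟨hΓ.mem t htT y₀ hy₀, by
      rw [mem_ball_zero_iff]; exact (hR t ht).trans_lt (lt_add_one R)⟩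
  have keyV : ∀ᶠ z : E × E in 𝓝 (y₀, y₀), z.1 ∈ V :=
    continuous_fst.continuousAt.eventually_mem (hV.mem_nhds hy₀)
  obtain ⟨r, hr, hball⟩ := Metric.eventually_nhds_iff_ball.1 (key.and keyV)
  refine ⟨r, hr, R + 1, fun y hy => (hball (y, y) ?_).2, fun y hy y' hy' t ht θ hθ => ?_⟩
  · rw [← ball_prod_same]; exact ⟨hy, hy⟩
  · have := (hball (y, y') (by rw [← ball_prod_same]; exact ⟨hy, hy'⟩)).1 (t, θ) ⟨ht, hθ⟩
    exact ⟨this.1, (mem_ball_zero_iff.1 this.2).le⟩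

/-- A flow has increments `Γ(t, y') - Γ(t, y) = M(t, y, y') (y' - y)` with a continuous `M`. -/
theorem IsLocalFlow.exists_increment [CompleteSpace E] {T : ℝ} {O : Set (ℝ × E)} {F : ℝ × E → E} {V : Set E}
    {Γ : ℝ × E → E} (hΓ : IsLocalFlow T O F V Γ) (hO : IsOpen O) (hV : IsOpen V)
    (hd : ∀ p ∈ posPart T O, DifferentiableAt ℝ F p)
    (hc : ContinuousOn (fderiv ℝ F) (posPart T O))
    (hb : ∀ R : ℝ, ∃ C : ℝ, ∀ p ∈ posPart T O, ‖p‖ ≤ R → ‖fderiv ℝ F p‖ ≤ C)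
    {y₀ : E} (hy₀ : y₀ ∈ V) {t₁ : ℝ} (ht₁ : t₁ < T) :
    ∃ r > 0, Metric.ball y₀ r ⊆ V ∧ ∃ M : ℝ → E → E → E →L[ℝ] E,
      ContinuousOn (fun q : ℝ × E × E => M q.1 q.2.1 q.2.2)
        (univ ×ˢ Metric.ball y₀ r ×ˢ Metric.ball y₀ r) ∧
      ∀ y ∈ Metric.ball y₀ r, ∀ y' ∈ Metric.ball y₀ r,
        (∀ t ≤ 0, M t y y' = 1) ∧
        (∀ t < t₁, Γ (t, y') - Γ (t, y) = M t y y' (y' - y)) ∧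
        ∀ t ∈ Ioo 0 t₁, HasDerivAt (fun τ => M τ y y')
          ((segmentMean F t (Γ (t, y)) (Γ (t, y'))).comp (M t y y')) t := by
  obtain ⟨r, hr, R, hrV, hseg⟩ := hΓ.exists_ball_segment_mem hO hV hy₀ ht₁
  obtain ⟨C, hC⟩ := hb R
  have hcont : ∀ t < T, ∀ y ∈ V, ContinuousAt Γ (t, y) := fun t ht y hy =>
    hΓ.continuousOn.continuousAt ((isOpen_Iio.prod hV).mem_nhds ⟨ht, hy⟩)
  have hseg' : ∀ y ∈ Metric.ball y₀ r, ∀ y' ∈ Metric.ball y₀ r, ∀ t ∈ Ioo 0 t₁,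
      ∀ θ ∈ Icc (0 : ℝ) 1, (t, Γ (t, y) + θ • (Γ (t, y') - Γ (t, y))) ∈ posPart T O ∧
        ‖fderiv ℝ F (t, Γ (t, y) + θ • (Γ (t, y') - Γ (t, y)))‖ ≤ C := by
    intro y hy y' hy' t ht θ hθ
    obtain ⟨h1, h2⟩ := hseg y hy y' hy' t ⟨ht.1.le, ht.2.le⟩ θ hθ
    have h3 : (t, Γ (t, y) + θ • (Γ (t, y') - Γ (t, y))) ∈ posPart T O :=
      ⟨h1, ⟨ht.1, ht.2.trans ht₁⟩, mem_univ _⟩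
    exact ⟨h3, hC _ h3 h2⟩
  let P : Set (E × E) := Metric.ball y₀ r ×ˢ Metric.ball y₀ r
  -- Setting the coefficient to zero outside `(0, t₁)` makes it bounded and measurable at all times,
  -- whatever `F` does at `t = 0`, and makes the fundamental solution equal to `1` at nonpositive
  -- times, where the flow is stationary.
  let A : ℝ → P → E →L[ℝ] E := fun t p =>
    (Ioo 0 t₁).indicator (fun t => segmentMean F t (Γ (t, p.1.1)) (Γ (t, p.1.2))) t
  have hA : ∀ t ∈ Ioo 0 t₁, ∀ p : P, A t p = segmentMean F t (Γ (t, p.1.1)) (Γ (t, p.1.2)) :=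
    fun t ht p => indicator_of_mem ht _
  have hA0 : ∀ t ∉ Ioo 0 t₁, ∀ p : P, A t p = 0 := fun t ht p => indicator_of_notMem ht _
  have hC0 : 0 ≤ max C 0 := le_max_right _ _
  have hbound : ∀ t p, ‖A t p‖ ≤ max C 0 := by
    intro t p
    by_cases ht : t ∈ Ioo 0 t₁
    · rw [hA t ht]
      exact (norm_segmentMean_le fun θ hθ =>
        (hseg' _ p.2.1 _ p.2.2 t ht θ hθ).2).trans (le_max_left _ _)
    · rw [hA0 t ht]; simp
  have hjoint : ∀ t ∈ Ioo 0 t₁, ∀ p : P, ContinuousAt (fun q : ℝ × P =>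
      segmentMean F q.1 (Γ (q.1, q.2.1.1)) (Γ (q.1, q.2.1.2))) (t, p) := by
    intro t ht p
    have htT : t < T := ht.2.trans ht₁
    refine continuousAt_segmentMean (C := C) (isOpen_posPart hO) hc continuousAt_fst ?_ ?_ ?_
    · exact (hcont t htT _ (hrV p.2.1)).comp (f := fun q : ℝ × P => (q.1, q.2.1.1)) (x := (t, p))
        (by fun_prop)
    · exact (hcont t htT _ (hrV p.2.2)).comp (f := fun q : ℝ × P => (q.1, q.2.1.2)) (x := (t, p))
        (by fun_prop)
    · have : ∀ᶠ q : ℝ × P in 𝓝 (t, p), q.1 ∈ Ioo 0 t₁ :=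
        continuousAt_fst.eventually_mem (isOpen_Ioo.mem_nhds ht)
      filter_upwards [this] with q hq θ hθ using hseg' _ q.2.2.1 _ q.2.2.2 q.1 hq θ hθ
  have hAt : ∀ t ∈ Ioo 0 t₁, ∀ p : P, ContinuousAt (fun τ => A τ p) t := by
    intro t ht p
    refine ((hjoint t ht p).comp (f := fun τ => (τ, p)) (by fun_prop)).congr ?_
    filter_upwards [isOpen_Ioo.mem_nhds ht] with τ hτ
    exact (hA τ hτ p).symm
  have hAp : ∀ t, Continuous (A t) := by
    intro t
    by_cases ht : t ∈ Ioo 0 t₁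
    · rw [funext (hA t ht), continuous_iff_continuousAt]
      exact fun p => (hjoint t ht p).comp (f := fun p => (t, p)) (by fun_prop)
    · rw [funext (hA0 t ht)]; exact continuous_const
  have hmeas : ∀ p, AEStronglyMeasurable (fun t => A t p) := by
    intro p
    refine (aestronglyMeasurable_indicator_iff measurableSet_Ioo).2 ?_
    refine ContinuousOn.aestronglyMeasurable (fun t ht => ?_) measurableSet_Ioo
    exact ((hjoint t ht p).comp (f := fun τ => (τ, p)) (by fun_prop)).continuousWithinAt
  obtain ⟨N, hNc, hN⟩ := exists_fundamental_solution hmeas hAp hbound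
  have hNint : ∀ p, ∀ a b, IntervalIntegrable (fun τ => A τ p * N τ p) volume a b := by
    intro p a b
    have h1 : IntervalIntegrable (fun τ => A τ p) volume a b :=
      (intervalIntegrable_const (c := max C 0)).mono_fun (hmeas p).restrict
        (Eventually.of_forall fun τ => by simpa [abs_of_nonneg hC0] using hbound τ p)
    exact h1.mul_continuousOn
      (hNc.comp (by fun_prop : Continuous fun τ : ℝ => (τ, p))).continuousOn
  have hNd : ∀ p, ∀ t ∈ Ioo 0 t₁, HasDerivAt (fun τ => N τ p) (A t p * N t p) t := by
    intro p t ht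
    have hmul : ∀ t ∈ Ioo 0 t₁, ContinuousAt (fun τ => A τ p * N τ p) t := fun t ht =>
      (hAt t ht p).mul (hNc.comp (by fun_prop : Continuous fun τ : ℝ => (τ, p))).continuousAt
    have h1 := intervalIntegral.integral_hasDerivAt_right (hNint p 0 t)
      (ContinuousAt.stronglyMeasurableAtFilter isOpen_Ioo hmul t ht) (hmul t ht)
    rw [show (fun τ => N τ p) = fun τ => 1 + ∫ σ in (0 : ℝ)..τ, A σ p * N σ p from
      funext fun τ => hN τ p]
    exact h1.const_add 1
  have hN0 : ∀ p, ∀ t ≤ 0, N t p = 1 := by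
    intro p t ht
    rw [hN t p, intervalIntegral.integral_congr_ae (g := fun _ => 0)]
    · simp
    · refine Eventually.of_forall fun τ hτ => ?_
      rw [uIoc_of_ge ht] at hτ
      rw [hA0 τ (fun h => absurd h.1 (not_lt.2 hτ.2)), zero_mul]
  classical
  refine ⟨r, hr, hrV, fun t y y' => if h : (y, y') ∈ Metric.ball y₀ r ×ˢ Metric.ball y₀ r then
    N t ⟨(y, y'), h⟩ else 0, ?_, ?_⟩
  · rw [continuousOn_iff_continuous_domRestrict]
    refine (hNc.comp (f := fun q : ↥((univ : Set ℝ) ×ˢ Metric.ball y₀ r ×ˢ Metric.ball y₀ r) =>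
      (q.1.1, (⟨(q.1.2.1, q.1.2.2), q.2.2⟩ : P))) (by fun_prop)).congr ?_
    rintro ⟨⟨t, y, y'⟩, -, hy, hy'⟩
    have : (y, y') ∈ Metric.ball y₀ r ×ˢ Metric.ball y₀ r := ⟨hy, hy'⟩
    simp only [Set.domRestrict_apply, Function.comp, dif_pos this]
  · intro y hy y' hy'
    have hp : (y, y') ∈ Metric.ball y₀ r ×ˢ Metric.ball y₀ r := ⟨hy, hy'⟩
    simp only [dif_pos hp]
    set p : P := ⟨(y, y'), hp⟩ with hpdef
    refine ⟨hN0 p, fun t ht => ?_, fun t ht => ?_⟩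
    · rcases le_or_gt t 0 with h0 | h0
      · rw [hN0 p t h0, hΓ.initial t h0 y (hrV hy), hΓ.initial t h0 y' (hrV hy')]
        simp
      · have hmem : ∀ τ ∈ Icc 0 t, τ < T := fun τ hτ => (hτ.2.trans_lt ht).trans ht₁
        -- The increment of the flow and `N τ p (y' - y)` solve the same linear equation with the
        -- same initial value.
        have := eq_zero_of_norm_deriv_le_mul_norm
          (f := fun τ => Γ (τ, y') - Γ (τ, y) - N τ p (y' - y)) (a := 0) (b := t) (K := max C 0)
          (f' := fun τ => A τ p (Γ (τ, y') - Γ (τ, y) - N τ p (y' - y))) h0.le ?_ ?_ ?_ ?_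
        · exact sub_eq_zero.1 this
        · intro τ hτ
          refine ContinuousAt.continuousWithinAt ?_
          have h1 : ContinuousAt (fun τ => Γ (τ, y)) τ :=
            (hcont τ (hmem τ hτ) y (hrV hy)).comp (f := fun τ => (τ, y)) (by fun_prop)
          have h2 : ContinuousAt (fun τ => Γ (τ, y')) τ :=
            (hcont τ (hmem τ hτ) y' (hrV hy')).comp (f := fun τ => (τ, y')) (by fun_prop)
          have h3 : ContinuousAt (fun τ => N τ p) τ :=
            (hNc.comp (by fun_prop : Continuous fun τ : ℝ => (τ, p))).continuousAt
          exact (h2.sub h1).sub (h3.clm_apply continuousAt_const)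
        · intro τ hτ
          have hτ' : τ ∈ Ioo 0 t₁ := ⟨hτ.1, hτ.2.trans ht⟩
          have hτT : τ ∈ Ioo 0 T := ⟨hτ.1, hτ'.2.trans ht₁⟩
          have h1 := hΓ.hasDerivAt τ hτT y (hrV hy)
          have h2 := hΓ.hasDerivAt τ hτT y' (hrV hy')
          have h3 := (hNd p τ hτ').clm_apply (hasDerivAt_const τ (y' - y))
          refine ((h2.sub h1).sub h3).congr_deriv ?_
          rw [← segmentMean_apply_sub hd hc fun θ hθ => (hseg' y hy y' hy' τ hτ' θ hθ).1,
            hA τ hτ' p]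
          simp [hpdef]
        · intro τ hτ
          exact (ContinuousLinearMap.le_opNorm _ _).trans (by gcongr; exact hbound τ p)
        · rw [hN0 p 0 le_rfl, hΓ.initial 0 le_rfl y (hrV hy), hΓ.initial 0 le_rfl y' (hrV hy')]
          simp
    · have := hNd p t ht
      rw [hA t ht p] at this
      exact this

end Flow

/-! ### Functions with derivatives bounded on bounded sets -/

section LocBounded

variable {V W W' : Type*} [NormedAddCommGroup V] [NormedSpace ℝ V] [NormedAddCommGroup W]
  [NormedSpace ℝ W] [NormedAddCommGroup W'] [NormedSpace ℝ W']

/-- Functions of class `C^n` on `S` whose derivatives up to order `n` are bounded on bounded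
subsets of `S`. -/
def LocBddContDiffOn (n : ℕ) (f : V → W) (S : Set V) : Prop :=
  ContDiffOn ℝ n f S ∧
    ∀ R : ℝ, ∃ C : ℝ, ∀ k ≤ n, ∀ p ∈ S, ‖p‖ ≤ R → ‖iteratedFDerivWithin ℝ k f S p‖ ≤ C

theorem LocBddContDiffOn.mono_order {n m : ℕ} {f : V → W} {S : Set V}
    (hf : LocBddContDiffOn n f S) (hm : m ≤ n) : LocBddContDiffOn m f S :=
  ⟨hf.1.of_le (by exact_mod_cast hm), fun R => (hf.2 R).imp fun _ hC k hk => hC k (hk.trans hm)⟩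

theorem LocBddContDiffOn.congr {n : ℕ} {f g : V → W} {S : Set V}
    (hf : LocBddContDiffOn n f S) (h : EqOn g f S) : LocBddContDiffOn n g S := by
  refine ⟨hf.1.congr h, fun R => (hf.2 R).imp fun _ hC k hk p hp hpR => ?_⟩
  rw [iteratedFDerivWithin_congr h hp]
  exact hC k hk p hp hpR

theorem LocBddContDiffOn.prodMk {n : ℕ} {f : V → W} {g : V → W'} {S : Set V} (hS : IsOpen S)
    (hf : LocBddContDiffOn n f S) (hg : LocBddContDiffOn n g S) :
    LocBddContDiffOn n (fun x => (f x, g x)) S := by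
  refine ⟨hf.1.prodMk hg.1, fun R => ?_⟩
  obtain ⟨C, hC⟩ := hf.2 R
  obtain ⟨C', hC'⟩ := hg.2 R
  refine ⟨max C C', fun k hk p hp hpR => ?_⟩
  rw [iteratedFDerivWithin_prodMk (hf.1 p hp) (hg.1 p hp) hS.uniqueDiffOn hp (by exact_mod_cast hk),
    ContinuousMultilinearMap.opNorm_prod]
  exact max_le_max (hC k hk p hp hpR) (hC' k hk p hp hpR)

theorem LocBddContDiffOn.comp_clm {n : ℕ} {f : V → W} {S : Set V} (hS : IsOpen S)
    (hf : LocBddContDiffOn n f S) (g : W' →L[ℝ] V) :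
    LocBddContDiffOn n (f ∘ g) (g ⁻¹' S) := by
  refine ⟨hf.1.comp_continuousLinearMap g, fun R => ?_⟩
  obtain ⟨C, hC⟩ := hf.2 (‖g‖ * R)
  refine ⟨max C 0 * (max 1 ‖g‖) ^ n, fun k hk p hp hpR => ?_⟩
  rw [g.iteratedFDerivWithin_comp_right hf.1 hS.uniqueDiffOn
    (hS.preimage g.continuous).uniqueDiffOn hp (by exact_mod_cast hk)]
  refine (ContinuousMultilinearMap.norm_compContinuousLinearMap_le _ _).trans ?_
  have h1 := hC k hk (g p) hp ((g.le_opNorm p).trans (by gcongr))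
  simp only [Finset.prod_const, Finset.card_univ, Fintype.card_fin]
  refine mul_le_mul (h1.trans (le_max_left _ _)) ?_ (by positivity) (le_max_right _ _)
  calc ‖g‖ ^ k ≤ (max 1 ‖g‖) ^ k := by gcongr; exact le_max_right _ _
    _ ≤ (max 1 ‖g‖) ^ n := pow_le_pow_right₀ (le_max_left _ _) hk

theorem LocBddContDiffOn.of_contDiff [FiniteDimensional ℝ V] {n : ℕ} {f : V → W} {S : Set V}
    (hS : IsOpen S) (hf : ContDiff ℝ n f) : LocBddContDiffOn n f S := by
  refine ⟨hf.contDiffOn, fun R => ?_⟩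
  have : ProperSpace V := FiniteDimensional.proper ℝ V
  have h : ∀ k ≤ n, ∃ C : ℝ, ∀ p ∈ Metric.closedBall (0 : V) R, ‖iteratedFDeriv ℝ k f p‖ ≤ C :=
    fun k hk => (isCompact_closedBall _ _).exists_bound_of_continuousOn
      (hf.continuous_iteratedFDeriv (by exact_mod_cast hk)).continuousOn
  choose! C hC using h
  refine ⟨∑ i ∈ Finset.range (n + 1), |C i|, fun k hk p hp hpR => ?_⟩
  rw [iteratedFDerivWithin_of_isOpen k hS hp]
  refine (hC k hk p (by simpa using hpR)).trans ((le_abs_self _).trans ?_)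
  exact Finset.single_le_sum (f := fun i => |C i|) (fun i _ => abs_nonneg _)
    (Finset.mem_range.2 (Nat.lt_succ_of_le hk))

theorem LocBddContDiffOn.clm_apply {n : ℕ} {f : V → W →L[ℝ] W'} {g : V → W} {S : Set V}
    (hS : IsOpen S) (hf : LocBddContDiffOn n f S) (hg : LocBddContDiffOn n g S) :
    LocBddContDiffOn n (fun x => f x (g x)) S := by
  refine ⟨hf.1.clm_apply hg.1, fun R => ?_⟩
  obtain ⟨C, hC⟩ := hf.2 R
  obtain ⟨C', hC'⟩ := hg.2 R
  refine ⟨∑ k ∈ Finset.range (n + 1), ∑ i ∈ Finset.range (k + 1),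
    (k.choose i : ℝ) * |C| * |C'|, fun k hk p hp hpR => ?_⟩
  refine (norm_iteratedFDerivWithin_clm_apply hf.1 hg.1 hS.uniqueDiffOn hp
    (by exact_mod_cast hk)).trans ?_
  refine le_trans ?_ (Finset.single_le_sum (f := fun k => ∑ i ∈ Finset.range (k + 1),
    (k.choose i : ℝ) * |C| * |C'|) (fun i _ => by positivity)
    (Finset.mem_range.2 (Nat.lt_succ_of_le hk)))
  refine Finset.sum_le_sum fun i hi => ?_
  have hi' : i ≤ k := Nat.lt_succ_iff.1 (Finset.mem_range.1 hi)
  gcongr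
  · exact (hC i (hi'.trans hk) p hp hpR).trans (le_abs_self _)
  · exact (hC' (k - i) ((Nat.sub_le _ _).trans hk) p hp hpR).trans (le_abs_self _)

theorem LocBddContDiffOn.fderiv {n : ℕ} {f : V → W} {S : Set V} (hS : IsOpen S)
    (hf : LocBddContDiffOn (n + 1) f S) : LocBddContDiffOn n (fderiv ℝ f) S := by
  have heq : EqOn (_root_.fderiv ℝ f) (fderivWithin ℝ f S) S :=
    fun x hx => (fderivWithin_of_isOpen hS hx).symm
  refine LocBddContDiffOn.congr ⟨?_, fun R => ?_⟩ heq
  · exact hf.1.fderivWithin hS.uniqueDiffOn (by norm_cast)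
  · refine (hf.2 R).imp fun C hC k hk p hp hpR => ?_
    rw [norm_iteratedFDerivWithin_fderivWithin hS.uniqueDiffOn hp]
    exact hC (k + 1) (by omega) p hp hpR

theorem LocBddContDiffOn.norm_fderiv_le {n : ℕ} {f : V → W} {S : Set V} (hS : IsOpen S)
    (hf : LocBddContDiffOn (n + 1) f S) (R : ℝ) :
    ∃ C : ℝ, ∀ p ∈ S, ‖p‖ ≤ R → ‖_root_.fderiv ℝ f p‖ ≤ C := by
  obtain ⟨C, hC⟩ := (hf.fderiv hS).2 R
  refine ⟨C, fun p hp hpR => ?_⟩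
  simpa using hC 0 (Nat.zero_le _) p hp hpR

end LocBounded

/-! ### Differentiability of flows -/

section Flow

variable {E : Type*} [NormedAddCommGroup E] [NormedSpace ℝ E]

/-- Continuity of `G` suffices: since `g` vanishes at `q₀`, the remainder `(G q - G q₀) (g q)` is
`o(1)` times `O(q - q₀)`. -/
theorem hasFDerivAt_clm_apply_of_eq_zero {V W W' : Type*} [NormedAddCommGroup V] [NormedSpace ℝ V]
    [NormedAddCommGroup W] [NormedSpace ℝ W] [NormedAddCommGroup W'] [NormedSpace ℝ W']
    {G : V → W →L[ℝ] W'} {g : V → W} {g' : V →L[ℝ] W} {q₀ : V} (hG : ContinuousAt G q₀)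
    (hg : HasFDerivAt g g' q₀) (h0 : g q₀ = 0) :
    HasFDerivAt (fun q => G q (g q)) ((G q₀).comp g') q₀ := by
  have h1 : HasFDerivAt (fun q => G q₀ (g q)) ((G q₀).comp g') q₀ :=
    (G q₀).hasFDerivAt.comp q₀ hg
  have h2 : HasFDerivAt (fun q => (G q - G q₀) (g q)) (0 : V →L[ℝ] W') q₀ := by
    rw [hasFDerivAt_iff_isLittleO]
    have ho : (fun q => G q - G q₀) =o[𝓝 q₀] fun _ => (1 : ℝ) :=
      (Asymptotics.isLittleO_one_iff ℝ).2 (by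
        have := hG.sub (continuousAt_const (y := G q₀)); simpa [ContinuousAt] using! this)
    have hO : g =O[𝓝 q₀] fun q => q - q₀ := by simpa [h0] using hg.isBigO_sub
    have := ho.norm_left.mul_isBigO hO.norm_norm
    simp only [one_mul] at this
    refine (Asymptotics.IsBigO.of_bound 1 (Eventually.of_forall fun q => ?_)).trans_isLittleO
      this.of_norm_right
    simpa [h0] using! (G q - G q₀).le_opNorm (g q)
  rw [← add_zero ((G q₀).comp g')]
  exact (h1.add h2).congr_of_eventuallyEq (Eventually.of_forall fun q => by simp)

/-- The spatial derivative of a flow. -/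
noncomputable def flowDeriv (Γ : ℝ × E → E) (q : ℝ × E) : E →L[ℝ] E :=
  fderiv ℝ (fun y => Γ (q.1, y)) q.2

variable [CompleteSpace E] {T : ℝ} {O : Set (ℝ × E)} {F : ℝ × E → E} {V : Set E} {Γ : ℝ × E → E}

/-- With `M` from `IsLocalFlow.exists_increment`, the spatial derivative at `y` is the diagonal
value `M t y y`, so continuity, initial value and variational equation pass from `M` to it. The
total derivative comes from writing the flow near `(t, y)` as `Γ (t', y) + M t' y y' (y' - y)`. -/
theorem IsLocalFlow.flowDeriv_spec (hΓ : IsLocalFlow T O F V Γ) (hO : IsOpen O) (hV : IsOpen V)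
    {n : ℕ} (hF : LocBddContDiffOn (n + 1) F (posPart T O)) :
    ContinuousOn (flowDeriv Γ) (Iio T ×ˢ V) ∧
    (∀ t ≤ 0, ∀ y ∈ V, t < T → flowDeriv Γ (t, y) = 1) ∧
    (∀ t ∈ Ioo 0 T, ∀ y ∈ V, HasDerivAt (fun τ => flowDeriv Γ (τ, y))
      (((fderiv ℝ F (t, Γ (t, y))).comp (ContinuousLinearMap.inr ℝ ℝ E)).comp
        (flowDeriv Γ (t, y))) t) ∧
    ∀ t ∈ Ioo 0 T, ∀ y ∈ V, HasFDerivAt Γ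
      ((ContinuousLinearMap.fst ℝ ℝ E).smulRight (F (t, Γ (t, y))) +
        (flowDeriv Γ (t, y)).comp (ContinuousLinearMap.snd ℝ ℝ E)) (t, y) := by
  have hpos := isOpen_posPart (T := T) hO
  have hd : ∀ p ∈ posPart T O, DifferentiableAt ℝ F p := fun p hp =>
    (hF.1.differentiableOn (by simp) p hp).differentiableAt (hpos.mem_nhds hp)
  have key : ∀ t < T, ∀ y ∈ V, ∃ t₁ ∈ Ioo t T, ∃ r > 0, Metric.ball y r ⊆ V ∧
      ∃ M : ℝ → E → E → E →L[ℝ] E, ContinuousOn (fun q : ℝ × E × E => M q.1 q.2.1 q.2.2)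
        (univ ×ˢ Metric.ball y r ×ˢ Metric.ball y r) ∧
      (∀ x ∈ Metric.ball y r, ∀ x' ∈ Metric.ball y r,
        (∀ t ≤ 0, M t x x' = 1) ∧
        (∀ t < t₁, Γ (t, x') - Γ (t, x) = M t x x' (x' - x)) ∧
        ∀ t ∈ Ioo 0 t₁, HasDerivAt (fun τ => M τ x x')
          ((segmentMean F t (Γ (t, x)) (Γ (t, x'))).comp (M t x x')) t) ∧
      ∀ t < t₁, ∀ x ∈ Metric.ball y r, flowDeriv Γ (t, x) = M t x x := by
    intro t ht y hy
    obtain ⟨t₁, ht₁⟩ := exists_between ht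
    obtain ⟨r, hr, hrV, M, hMc, hM⟩ := hΓ.exists_increment hO hV hd
      ((hF.fderiv hpos).1.continuousOn) (hF.norm_fderiv_le hpos) hy ht₁.2
    refine ⟨t₁, ht₁, r, hr, hrV, M, hMc, hM, fun τ hτ x hx => ?_⟩
    have h1 : ContinuousAt (fun x' => M τ x x') x := by
      have := hMc.continuousAt (x := (τ, x, x)) ((isOpen_univ.prod
        (Metric.isOpen_ball.prod Metric.isOpen_ball)).mem_nhds ⟨mem_univ _, hx, hx⟩)
      exact this.comp (f := fun x' => (τ, x, x')) (by fun_prop)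
    have h2 : HasFDerivAt (fun x' => Γ (τ, x) + M τ x x' (x' - x)) (M τ x x) x := by
      have := hasFDerivAt_clm_apply_of_eq_zero h1 ((hasFDerivAt_id x).sub_const x) (by simp)
      simpa using! this.const_add (Γ (τ, x))
    refine HasFDerivAt.fderiv (h2.congr_of_eventuallyEq ?_)
    filter_upwards [Metric.isOpen_ball.mem_nhds hx] with x' hx'
    rw [← (hM x hx x' hx').2.1 τ hτ]; simp
  refine ⟨?_, ?_, ?_, ?_⟩
  · rintro ⟨t, y⟩ ⟨ht, hy⟩
    obtain ⟨t₁, ht₁, r, hr, -, M, hMc, -, hJ⟩ := key t ht y hy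
    have hyr := Metric.mem_ball_self (x := y) hr
    have h1 : ContinuousAt (fun q : ℝ × E => M q.1 q.2 q.2) (t, y) := by
      have := hMc.continuousAt (x := (t, y, y)) ((isOpen_univ.prod
        (Metric.isOpen_ball.prod Metric.isOpen_ball)).mem_nhds ⟨mem_univ _, hyr, hyr⟩)
      exact this.comp (f := fun q : ℝ × E => (q.1, q.2, q.2)) (x := (t, y)) (by fun_prop)
    refine (h1.congr ?_).continuousWithinAt
    filter_upwards [(isOpen_Iio.prod Metric.isOpen_ball).mem_nhds (x := (t, y)) ⟨ht₁.1, hyr⟩]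
      with q hq
    exact (hJ q.1 hq.1 q.2 hq.2).symm
  · intro t ht y hy htT
    obtain ⟨t₁, ht₁, r, hr, -, M, -, hM, hJ⟩ := key t htT y hy
    have hyr := Metric.mem_ball_self (x := y) hr
    rw [hJ t ht₁.1 y hyr, (hM y hyr y hyr).1 t ht]
  · intro t ht y hy
    obtain ⟨t₁, ht₁, r, hr, -, M, -, hM, hJ⟩ := key t ht.2 y hy
    have hyr := Metric.mem_ball_self (x := y) hr
    have h1 := (hM y hyr y hyr).2.2 t ⟨ht.1, ht₁.1⟩
    rw [segmentMean_self, ← hJ t ht₁.1 y hyr] at h1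
    refine h1.congr_of_eventuallyEq ?_
    filter_upwards [Iio_mem_nhds ht₁.1] with τ hτ using hJ τ hτ y hyr
  · intro t ht y hy
    obtain ⟨t₁, ht₁, r, hr, -, M, hMc, hM, hJ⟩ := key t ht.2 y hy
    have hyr := Metric.mem_ball_self (x := y) hr
    have h1 : ContinuousAt (fun q : ℝ × E => M q.1 y q.2) (t, y) := by
      have := hMc.continuousAt (x := (t, y, y)) ((isOpen_univ.prod
        (Metric.isOpen_ball.prod Metric.isOpen_ball)).mem_nhds ⟨mem_univ _, hyr, hyr⟩)
      exact this.comp (f := fun q : ℝ × E => (q.1, y, q.2)) (x := (t, y)) (by fun_prop)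
    have h2 := hasFDerivAt_clm_apply_of_eq_zero h1
      ((hasFDerivAt_snd (𝕜 := ℝ) (p := (t, y))).sub_const y) (by simp)
    have h3 : HasFDerivAt (fun q : ℝ × E => Γ (q.1, y))
        ((ContinuousLinearMap.fst ℝ ℝ E).smulRight (F (t, Γ (t, y)))) (t, y) := by
      have := (hΓ.hasDerivAt t ht y hy).hasFDerivAt.comp (t, y)
        (hasFDerivAt_fst (𝕜 := ℝ) (p := (t, y)))
      refine this.congr_fderiv ?_
      ext <;> simp
    rw [hJ t ht₁.1 y hyr]
    refine (h3.add h2).congr_of_eventuallyEq ?_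
    filter_upwards [(isOpen_Iio.prod Metric.isOpen_ball).mem_nhds (x := (t, y)) ⟨ht₁.1, hyr⟩]
      with q hq
    simp only [Pi.add_apply]
    rw [← (hM y hyr q.2 hq.2).2.1 q.1 hq.1]; simp

/-- The field whose flow is the tangent map of the flow of `F`. -/
noncomputable def tangentField (F : ℝ × E → E) (q : ℝ × E × E) : E × E :=
  (F (q.1, q.2.1), fderiv ℝ F (q.1, q.2.1) (0, q.2.2))

/-- The projection `(t, x, v) ↦ (t, x)`. -/
noncomputable def basePoint (E : Type*) [NormedAddCommGroup E] [NormedSpace ℝ E] :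
    ℝ × E × E →L[ℝ] ℝ × E :=
  (ContinuousLinearMap.fst ℝ ℝ (E × E)).prod
    ((ContinuousLinearMap.fst ℝ E E).comp (ContinuousLinearMap.snd ℝ ℝ (E × E)))

omit [CompleteSpace E] in
theorem posPart_preimage_basePoint :
    posPart T (basePoint E ⁻¹' O) = basePoint E ⁻¹' posPart T O := by
  ext ⟨t, x, v⟩
  simp [posPart, basePoint]

-- The tangent field costs one derivative and is linear in the unbounded variable `v`, so global
-- bounds on `F` would not pass to it. This is why bounds are required on bounded sets only.
omit [CompleteSpace E] in
theorem LocBddContDiffOn.tangentField [FiniteDimensional ℝ E] (hO : IsOpen O) {n : ℕ}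
    (hF : LocBddContDiffOn (n + 1) F (posPart T O)) :
    LocBddContDiffOn n (tangentField F) (posPart T (basePoint E ⁻¹' O)) := by
  rw [posPart_preimage_basePoint]
  have hpos := isOpen_posPart (T := T) hO
  have hpre : IsOpen (basePoint E ⁻¹' posPart T O) := hpos.preimage (basePoint E).continuous
  refine ((hF.mono_order n.le_succ).comp_clm hpos (basePoint E)).prodMk hpre ?_
  refine ((hF.fderiv hpos).comp_clm hpos (basePoint E)).clm_apply hpre
    (LocBddContDiffOn.of_contDiff hpre (f := fun q : ℝ × E × E => ((0 : ℝ), q.2.2)) ?_)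
  fun_prop

/-- The second component is the variational equation. This allows induction on the order of
differentiability. -/
theorem IsLocalFlow.tangent (hΓ : IsLocalFlow T O F V Γ) (hO : IsOpen O) (hV : IsOpen V)
    (hT : 0 < T) {n : ℕ} (hF : LocBddContDiffOn (n + 1) F (posPart T O)) :
    IsLocalFlow T (basePoint E ⁻¹' O) (HydrostaticEuler.tangentField F) (V ×ˢ univ)
      (fun q => (Γ (q.1, q.2.1), flowDeriv Γ (q.1, q.2.1) q.2.2)) := by
  obtain ⟨hJc, hJ0, hJd, -⟩ := hΓ.flowDeriv_spec hO hV hF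
  have hmap : MapsTo (fun q : ℝ × E × E => (q.1, q.2.1)) (Iio T ×ˢ V ×ˢ univ) (Iio T ×ˢ V) :=
    fun q hq => ⟨hq.1, hq.2.1⟩
  constructor
  · refine (hΓ.continuousOn.comp (by fun_prop) hmap).prodMk ?_
    exact (hJc.comp (by fun_prop) hmap).clm_apply (by fun_prop)
  · exact fun t ht y hy => hΓ.mem t ht y.1 hy.1
  · rintro t ht ⟨y, v⟩ ⟨hy, -⟩
    simp [hΓ.initial t ht y hy, hJ0 t ht y hy (ht.trans_lt hT)]
  · rintro t ht ⟨y, v⟩ ⟨hy, -⟩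
    refine (hΓ.hasDerivAt t ht y hy).prodMk ?_
    have := (hJd t ht y hy).clm_apply (hasDerivAt_const t v)
    simpa using! this

end Flow

/-- The flow of a `C^n` field, with derivatives that are bounded up to the initial time, is `C^n`
at positive times. -/
theorem IsLocalFlow.contDiffOn {n : ℕ} : ∀ {E : Type*} [NormedAddCommGroup E] [NormedSpace ℝ E]
    [FiniteDimensional ℝ E] {T : ℝ} {O : Set (ℝ × E)} {F : ℝ × E → E} {V : Set E}
    {Γ : ℝ × E → E}, IsLocalFlow T O F V Γ → IsOpen O → IsOpen V → 0 < T →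
    LocBddContDiffOn n F (posPart T O) → ContDiffOn ℝ n Γ (Ioo 0 T ×ˢ V) := by
  induction n with
  | zero =>
    intro E _ _ _ T O F V Γ hΓ _ _ _ _
    exact contDiffOn_zero.2 (hΓ.continuousOn.mono (prod_mono_left Ioo_subset_Iio_self))
  | succ n ih =>
    intro E _ _ _ T O F V Γ hΓ hO hV hT hF
    have : CompleteSpace E := FiniteDimensional.complete ℝ E
    have hopen : IsOpen (Ioo 0 T ×ˢ V) := isOpen_Ioo.prod hV
    obtain ⟨-, -, -, hd⟩ := hΓ.flowDeriv_spec hO hV hF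
    -- The induction doubles the space: the tangent flow in `E × E` is driven by a field of class
    -- `C^n`, hence is `C^n`, and contains both `Γ` and its spatial derivative. The time derivative
    -- is `F` along the flow.
    have htan := ih (hΓ.tangent hO hV hT hF) (hO.preimage (basePoint E).continuous)
      (hV.prod isOpen_univ) hT (hF.tangentField hO)
    have hJ : ContDiffOn ℝ n (flowDeriv Γ) (Ioo 0 T ×ˢ V) := by
      refine contDiffOn_clm_apply.2 fun v => ?_
      exact htan.snd.comp (t := Ioo 0 T ×ˢ V ×ˢ univ) (f := fun q : ℝ × E => (q.1, q.2, v))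
        (by fun_prop) (fun q hq => ⟨hq.1, hq.2, mem_univ _⟩)
    have hΓn : ContDiffOn ℝ n Γ (Ioo 0 T ×ˢ V) :=
      htan.fst.comp (t := Ioo 0 T ×ˢ V ×ˢ univ) (f := fun q : ℝ × E => (q.1, q.2, (0 : E)))
        (by fun_prop) (fun q hq => ⟨hq.1, hq.2, mem_univ _⟩)
    have hFΓ : ContDiffOn ℝ n (fun q : ℝ × E => F (q.1, Γ q)) (Ioo 0 T ×ˢ V) :=
      (hF.mono_order n.le_succ).1.comp (by fun_prop)
        (fun q hq => ⟨hΓ.mem q.1 hq.1.2 q.2 hq.2, hq.1, mem_univ _⟩)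
    push_cast
    refine (contDiffOn_succ_iff_fderiv_of_isOpen hopen).2
      ⟨fun q hq => (hd q.1 hq.1 q.2 hq.2).differentiableAt.differentiableWithinAt,
        by simp, ?_⟩
    refine ContDiffOn.congr (f := fun q => (ContinuousLinearMap.fst ℝ ℝ E).smulRight (F (q.1, Γ q))
      + (flowDeriv Γ q).comp (ContinuousLinearMap.snd ℝ ℝ E)) ?_
      (fun q hq => (hd q.1 hq.1 q.2 hq.2).fderiv)
    exact (contDiffOn_const.smulRight hFΓ).add (hJ.clm_comp contDiffOn_const)

/-! ### Integral curves of Lipschitz fields on short intervals -/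

section Trajectories

variable {E : Type*} [NormedAddCommGroup E] [NormedSpace ℝ E]

/-- `α` is an integral curve of `F` on `[0, T]`. -/
def IsTrajectory (F : ℝ × E → E) (T : ℝ) (α : ℝ → E) : Prop :=
  ∀ t ∈ Icc 0 T, HasDerivWithinAt α (F (t, α t)) (Icc 0 T) t

variable {F : ℝ × E → E} {T : ℝ} {α β : ℝ → E} {K : ℝ≥0}

theorem IsTrajectory.continuousOn (hα : IsTrajectory F T α) : ContinuousOn α (Icc 0 T) :=
  fun t ht => (hα t ht).continuousWithinAt

theorem IsTrajectory.hasDerivAt (hα : IsTrajectory F T α) {t : ℝ} (ht : t ∈ Ioo 0 T) :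
    HasDerivAt α (F (t, α t)) t :=
  (hα t (Ioo_subset_Icc_self ht)).hasDerivAt (Icc_mem_nhds ht.1 ht.2)

/-- If `m` is the maximum of `‖α - β‖`, the difference changes by at most `K * T * m ≤ m / 2`; hence
`m ≤ 2 * ‖α t - β t‖` for every reference time `t`. Unlike a forward Gronwall bound, this compares
earlier and later times symmetrically. -/
theorem IsTrajectory.norm_sub_sub_le (hα : IsTrajectory F T α) (hβ : IsTrajectory F T β)
    (hF : LipschitzWith K F) (hKT : K * T ≤ 1 / 2) {s t : ℝ} (hs : s ∈ Icc 0 T)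
    (ht : t ∈ Icc 0 T) :
    ‖(α s - β s) - (α t - β t)‖ ≤ 2 * K * T * ‖α t - β t‖ := by
  have hT : 0 ≤ T := hs.1.trans hs.2
  obtain ⟨r, hr, hmax⟩ := isCompact_Icc.exists_isMaxOn ⟨s, hs⟩
    (hα.continuousOn.sub hβ.continuousOn).norm
  set m := ‖α r - β r‖ with hm
  have hinc : ∀ s ∈ Icc 0 T, ‖(α s - β s) - (α t - β t)‖ ≤ K * T * m := by
    intro s hs
    refine ((convex_Icc 0 T).norm_image_sub_le_of_norm_hasDerivWithin_le
      (f := fun τ => α τ - β τ) (C := K * m) (fun τ hτ => (hα τ hτ).sub (hβ τ hτ))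
      (fun τ hτ => ?_) ht hs).trans ?_
    · refine (hF.norm_sub_le (τ, α τ) (τ, β τ)).trans ?_
      simp only [Prod.mk_sub_mk, sub_self, Prod.norm_mk, norm_zero, norm_nonneg, sup_of_le_right]
      gcongr
      exact hmax hτ
    · have : ‖s - t‖ ≤ T := by
        rw [Real.norm_eq_abs, abs_le]; constructor <;> linarith [hs.1, hs.2, ht.1, ht.2]
      calc K * m * ‖s - t‖ ≤ K * m * T := by gcongr
        _ = K * T * m := by ring
  have hm2 : m ≤ 2 * ‖α t - β t‖ := by
    have h1 : m ≤ ‖(α r - β r) - (α t - β t)‖ + ‖α t - β t‖ := by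
      simpa using norm_add_le ((α r - β r) - (α t - β t)) (α t - β t)
    have h2 := hinc r hr
    have h3 : K * T * m ≤ 1 / 2 * m := by gcongr
    linarith
  calc _ ≤ K * T * m := hinc s hs
    _ ≤ K * T * (2 * ‖α t - β t‖) := by gcongr
    _ = _ := by ring

theorem IsTrajectory.norm_sub_le (hα : IsTrajectory F T α) (hβ : IsTrajectory F T β)
    (hF : LipschitzWith K F) (hKT : K * T ≤ 1 / 2) {s t : ℝ} (hs : s ∈ Icc 0 T)
    (ht : t ∈ Icc 0 T) : ‖α s - β s‖ ≤ 2 * ‖α t - β t‖ := by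
  have h1 := hα.norm_sub_sub_le hβ hF hKT hs ht
  have h2 : ‖α s - β s‖ ≤ ‖(α s - β s) - (α t - β t)‖ + ‖α t - β t‖ := by
    simpa using norm_add_le ((α s - β s) - (α t - β t)) (α t - β t)
  nlinarith [norm_nonneg (α t - β t)]

theorem IsTrajectory.eqOn (hα : IsTrajectory F T α) (hβ : IsTrajectory F T β)
    (hF : LipschitzWith K F) (hKT : K * T ≤ 1 / 2) {t : ℝ} (ht : t ∈ Icc 0 T)
    (h : α t = β t) : EqOn α β (Icc 0 T) := by
  intro s hs
  have := hα.norm_sub_le hβ hF hKT hs ht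
  rw [h, sub_self, norm_zero, mul_zero] at this
  exact sub_eq_zero.1 (norm_le_zero_iff.1 this)

theorem exists_isTrajectory [CompleteSpace E] (hF : LipschitzWith K F)
    (hKT : K * T ≤ 1 / 2) {t₀ : ℝ} (ht₀ : t₀ ∈ Icc 0 T) (y : E) :
    ∃ α, IsTrajectory F T α ∧ α t₀ = y := by
  have hT : 0 ≤ T := ht₀.1.trans ht₀.2
  -- `b` bounds `F (t, y)` for all `t` in `[0, T]`. In the ball of radius `2 * T * b` the speed is
  -- at most `b + K * (2 * T * b) ≤ 2 * b`, so a curve cannot leave that ball within time `T`.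
  set b : ℝ := ‖F (t₀, y)‖ + K * T with hb
  have hb0 : 0 ≤ b := by positivity
  have hpl : IsPicardLindelof (fun t x => F (t, x)) (⟨t₀, ht₀⟩ : Icc 0 T) y
      ⟨2 * T * b, by positivity⟩ 0 ⟨b + K * (2 * T * b), by positivity⟩ K := by
    constructor
    · exact fun t _ => LipschitzWith.lipschitzOnWith fun x x' => by
        simpa [Prod.edist_eq] using hF (t, x) (t, x')
    · exact fun x _ => (hF.continuous.comp (by fun_prop)).continuousOn
    · intro t ht x hx
      rw [mem_closedBall_iff_norm] at hx
      have h1 := hF.norm_sub_le (t, x) (t₀, y)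
      have h2 : ‖t - t₀‖ ≤ T := by
        rw [Real.norm_eq_abs, abs_le]; constructor <;> linarith [ht.1, ht.2, ht₀.1, ht₀.2]
      have h3 : ‖(t, x) - (t₀, y)‖ ≤ T + 2 * T * b := by
        rw [Prod.mk_sub_mk, Prod.norm_mk]
        refine max_le (h2.trans ?_) (hx.trans ?_)
        · have : 0 ≤ 2 * T * b := by positivity
          linarith
        · change 2 * T * b ≤ T + 2 * T * b
          linarith
      have h4 : ‖F (t, x)‖ ≤ ‖F (t, x) - F (t₀, y)‖ + ‖F (t₀, y)‖ := by
        simpa using norm_add_le (F (t, x) - F (t₀, y)) (F (t₀, y))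
      have h5 : (K : ℝ) * ‖(t, x) - (t₀, y)‖ ≤ K * (T + 2 * T * b) := by gcongr
      change ‖F (t, x)‖ ≤ b + K * (2 * T * b)
      rw [hb] at *
      linarith
    · have h1 : max (T - t₀) (t₀ - 0) ≤ T := max_le (by linarith [ht₀.1]) (by linarith [ht₀.2])
      change (b + K * (2 * T * b)) * max (T - t₀) (t₀ - 0) ≤ 2 * T * b - 0
      calc (b + K * (2 * T * b)) * max (T - t₀) (t₀ - 0) ≤ (b + K * (2 * T * b)) * T := by gcongr
        _ = T * b + K * T * (2 * T * b) := by ring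
        _ ≤ T * b + 1 / 2 * (2 * T * b) := by gcongr
        _ = 2 * T * b - 0 := by ring
  obtain ⟨α, h0, hα⟩ := hpl.exists_eq_forall_mem_Icc_hasDerivWithinAt₀
  exact ⟨α, hα, h0⟩

theorem exists_flow [CompleteSpace E] (hF : LipschitzWith K F) (hT : 0 < T)
    (hKT : K * T ≤ 1 / 2) :
    ∃ Φ : ℝ × E → E, ContinuousOn Φ (Iio T ×ˢ univ) ∧ (∀ t ≤ 0, ∀ y, Φ (t, y) = y) ∧
      ∀ y, IsTrajectory F T fun t => Φ (t, y) := by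
  choose α hα h0 using fun y => exists_isTrajectory hF hKT (left_mem_Icc.2 hT.le) y
  -- The maximum freezes the flow at negative times, as `IsLocalFlow` requires.
  refine ⟨fun q => α q.2 (max q.1 0), ?_, fun t ht y => by simp [max_eq_right ht, h0],
    fun y t ht => ?_⟩
  · have hmem : ∀ t < T, max t 0 ∈ Icc 0 T := fun t ht =>
      ⟨le_max_right _ _, max_le ht.le hT.le⟩
    refine continuousOn_prod_of_continuousOn_lipschitzOnWith' _ 2 (fun t ht => ?_) fun y _ => ?_
    · refine LipschitzOnWith.of_dist_le_mul fun y _ y' _ => ?_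
      have := (hα y).norm_sub_le (hα y') hF hKT (hmem t ht) (left_mem_Icc.2 hT.le)
      rw [h0, h0] at this
      simpa [dist_eq_norm] using this
    · exact (hα y).continuousOn.comp (by fun_prop) hmem
  · have heq : EqOn (fun t => α y (max t 0)) (α y) (Icc 0 T) := fun t ht => by
      simp [max_eq_left ht.1]
    have h1 := (hα y t ht).congr heq (heq ht)
    simpa [max_eq_left ht.1] using! h1

end Trajectories

/-! ### Derivative and Lipschitz bounds for `C_b^s` functions -/

section CbOn

variable {V W W' : Type*} [NormedAddCommGroup V] [NormedSpace ℝ V] [NormedAddCommGroup W]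
  [NormedSpace ℝ W] [NormedAddCommGroup W'] [NormedSpace ℝ W']

theorem CbOn.locBddContDiffOn {s : ℕ} {f : V → W} {S : Set V} (hf : CbOn s f S) :
    LocBddContDiffOn s f S := by
  obtain ⟨C, hC⟩ := hf.2
  exact ⟨hf.1, fun _ => ⟨C, fun k hk p hp _ => hC k hk p hp⟩⟩

theorem CbOn.exists_norm_fderiv_le {s : ℕ} (hs : 1 ≤ s) {f : V → W} {S : Set V} (hS : IsOpen S)
    (hf : CbOn s f S) :
    ∃ C : ℝ≥0, ∀ p ∈ S, DifferentiableAt ℝ f p ∧ ‖fderiv ℝ f p‖ ≤ C := by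
  obtain ⟨C, hC⟩ := hf.2
  refine ⟨C.toNNReal, fun p hp => ⟨?_, ?_⟩⟩
  · exact (hf.1.differentiableOn (by exact_mod_cast (by omega : s ≠ 0)) p hp).differentiableAt
      (hS.mem_nhds hp)
  · have := hC 1 hs p hp
    rw [norm_iteratedFDerivWithin_one f (hS.uniqueDiffOn p hp), fderivWithin_of_isOpen hS hp] at this
    exact this.trans (Real.le_coe_toNNReal C)

theorem lipschitzOnWith_of_convex {f : V → W} {S : Set V} (hS : Convex ℝ S) {C : ℝ≥0}
    (h : ∀ p ∈ S, DifferentiableAt ℝ f p ∧ ‖fderiv ℝ f p‖ ≤ C) : LipschitzOnWith C f S :=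
  hS.lipschitzOnWith_of_nnnorm_fderiv_le (fun p hp => (h p hp).1) fun p hp => (h p hp).2

end CbOn

/-! ### Lipschitz bound between two graphs -/

section Graph

variable {H W : Type*} [NormedAddCommGroup H] [NormedSpace ℝ H] [NormedAddCommGroup W]
  [NormedSpace ℝ W]

/-- A function with bounded derivative is Lipschitz on the region between two Lipschitz graphs. -/
theorem lipschitzOnWith_between_graphs {J : Set ℝ} (hJ : Convex ℝ J) {b : H → ℝ} {h : ℝ × H → ℝ}
    {f : ℝ × H × ℝ → W} {B C : ℝ≥0}
    (hb : ∀ x, DifferentiableAt ℝ b x ∧ ‖fderiv ℝ b x‖ ≤ B)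
    (hh : ∀ q ∈ J ×ˢ (univ : Set H), DifferentiableAt ℝ h q ∧ ‖fderiv ℝ h q‖ ≤ B)
    (hbh : ∀ q ∈ J ×ˢ (univ : Set H), b q.2 < h q)
    (hf : ∀ q : ℝ × H × ℝ, q.1 ∈ J → b q.2.1 < q.2.2 → q.2.2 < h (q.1, q.2.1) →
      DifferentiableAt ℝ f q ∧ ‖fderiv ℝ f q‖ ≤ C) :
    LipschitzOnWith (C * (2 * (1 + 2 * B))) f
      {q | q.1 ∈ J ∧ b q.2.1 < q.2.2 ∧ q.2.2 < h (q.1, q.2.1)} := by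
  refine LipschitzOnWith.of_dist_le_mul ?_
  rintro ⟨t₂, x₂, z₂⟩ ⟨hJ₂, hb₂, hh₂⟩ ⟨t₁, x₁, z₁⟩ ⟨hJ₁, hb₁, hh₁⟩
  simp only at hJ₂ hb₂ hh₂ hJ₁ hb₁ hh₁
  have hpos : 0 < h (t₁, x₁) - b x₁ := by linarith
  -- `l` is the relative height of the first point in its column. The graph `ζ` of constant relative
  -- height `l` passes through that point, stays in the region and lies over a convex base. The mean
  -- value inequality is applied along this graph and then vertically over `(t₂, x₂)`; each part
  -- contributes `C * (1 + 2 * B)`.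
  obtain ⟨l, hl, hlz⟩ : ∃ l ∈ Ioo (0 : ℝ) 1, (1 - l) * b x₁ + l * h (t₁, x₁) = z₁ := by
    refine ⟨(z₁ - b x₁) / (h (t₁, x₁) - b x₁), ⟨by apply div_pos <;> linarith, ?_⟩, ?_⟩
    · rw [div_lt_one hpos]; linarith
    · field_simp; ring
  let ζ : ℝ × H → ℝ := fun q => (1 - l) * b q.2 + l * h q
  let S : Set (ℝ × H) := J ×ˢ univ
  have hSconv : Convex ℝ S := hJ.prod convex_univ
  have hζlt : ∀ q ∈ S, b q.2 < ζ q ∧ ζ q < h q := fun q hq => by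
    have := hbh q hq
    constructor <;> simp only [ζ] <;> nlinarith [hl.1, hl.2]
  let ζ' : ℝ × H → ℝ × H →L[ℝ] ℝ := fun q =>
    (1 - l) • (fderiv ℝ b q.2).comp (ContinuousLinearMap.snd ℝ ℝ H) + l • fderiv ℝ h q
  have hζd : ∀ q ∈ S, HasFDerivAt ζ (ζ' q) q := fun q hq =>
    (((hb q.2).1.hasFDerivAt.comp q hasFDerivAt_snd).const_mul (1 - l)).add
      ((hh q hq).1.hasFDerivAt.const_mul l)
  have hζn : ∀ q ∈ S, ‖ζ' q‖ ≤ 2 * B := fun q hq => by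
    refine (norm_add_le _ _).trans ?_
    rw [norm_smul, norm_smul, Real.norm_eq_abs, Real.norm_eq_abs, abs_of_pos hl.1,
      abs_of_pos (sub_pos.2 hl.2)]
    have h1 : ‖(fderiv ℝ b q.2).comp (ContinuousLinearMap.snd ℝ ℝ H)‖ ≤ B := by
      refine (ContinuousLinearMap.opNorm_comp_le _ _).trans ?_
      calc _ ≤ (B : ℝ) * 1 := mul_le_mul (hb q.2).2 (ContinuousLinearMap.norm_snd_le ..)
            (norm_nonneg _) B.2
        _ = B := mul_one _
    nlinarith [(hh q hq).2, hl.1, hl.2, B.2, norm_nonneg (fderiv ℝ h q), norm_nonneg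
      ((fderiv ℝ b q.2).comp (ContinuousLinearMap.snd ℝ ℝ H)), B.coe_nonneg]
  have hq₁ : (t₁, x₁) ∈ S := ⟨hJ₁, mem_univ _⟩
  have hq₂ : (t₂, x₂) ∈ S := ⟨hJ₂, mem_univ _⟩
  have hN : ‖(t₂, x₂) - (t₁, x₁)‖ ≤ dist (t₂, x₂, z₂) (t₁, x₁, z₁) := by
    simp only [dist_eq_norm, Prod.mk_sub_mk, Prod.norm_mk]
    exact max_le_max le_rfl (le_max_left _ _)
  have hζ₁ : ζ (t₁, x₁) = z₁ := hlz
  have hζ₂ : ‖ζ (t₂, x₂) - z₁‖ ≤ 2 * B * ‖(t₂, x₂) - (t₁, x₁)‖ := by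
    rw [← hζ₁]
    exact hSconv.norm_image_sub_le_of_norm_hasFDerivWithin_le
      (fun q hq => (hζd q hq).hasFDerivWithinAt) hζn hq₁ hq₂
  have hG : ‖f (t₂, x₂, ζ (t₂, x₂)) - f (t₁, x₁, ζ (t₁, x₁))‖ ≤
      C * (1 + 2 * B) * ‖(t₂, x₂) - (t₁, x₁)‖ := by
    refine hSconv.norm_image_sub_le_of_norm_hasFDerivWithin_le
      (f := fun q : ℝ × H => f (q.1, q.2, ζ q))
      (f' := fun q => (fderiv ℝ f (q.1, q.2, ζ q)).comp
        ((ContinuousLinearMap.fst ℝ ℝ H).prod ((ContinuousLinearMap.snd ℝ ℝ H).prod (ζ' q))))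
      (fun q hq => ?_) (fun q hq => ?_) hq₁ hq₂
    · have h1 := (hf (q.1, q.2, ζ q) hq.1 (hζlt q hq).1 (hζlt q hq).2).1.hasFDerivAt
      have h2 := (hasFDerivAt_fst (𝕜 := ℝ) (p := q)).prodMk
        ((hasFDerivAt_snd (𝕜 := ℝ) (p := q)).prodMk (hζd q hq))
      exact (h1.comp q h2).hasFDerivWithinAt
    · refine (ContinuousLinearMap.opNorm_comp_le _ _).trans ?_
      refine mul_le_mul (hf (q.1, q.2, ζ q) hq.1 (hζlt q hq).1 (hζlt q hq).2).2 ?_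
        (norm_nonneg _) C.2
      have hB : (0 : ℝ) ≤ B := B.2
      refine ContinuousLinearMap.opNorm_le_bound _ (by positivity) fun v => ?_
      simp only [ContinuousLinearMap.prod_apply, Prod.norm_mk]
      have h1 : ‖v‖ ≤ (1 + 2 * B) * ‖v‖ := by nlinarith [norm_nonneg v]
      refine max_le ((norm_fst_le v).trans h1) (max_le ((norm_snd_le v).trans h1) ?_)
      refine ((ζ' q).le_of_opNorm_le (hζn q hq) v).trans ?_
      nlinarith [norm_nonneg v]
  have hV : ‖f (t₂, x₂, z₂) - f (t₂, x₂, ζ (t₂, x₂))‖ ≤ C * ‖z₂ - ζ (t₂, x₂)‖ := by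
    refine (convex_Ioo (b x₂) (h (t₂, x₂))).norm_image_sub_le_of_norm_hasFDerivWithin_le
      (f := fun z : ℝ => f (t₂, x₂, z))
      (f' := fun z => (fderiv ℝ f (t₂, x₂, z)).comp
        ((ContinuousLinearMap.inr ℝ ℝ (H × ℝ)).comp (ContinuousLinearMap.inr ℝ H ℝ)))
      (fun z hz => ?_) (fun z hz => ?_) (hζlt _ hq₂) ⟨hb₂, hh₂⟩
    · have h1 := (hf (t₂, x₂, z) hJ₂ hz.1 hz.2).1.hasFDerivAt
      have h2 := (hasFDerivAt_prodMk_right (𝕜 := ℝ) t₂ (x₂, z)).comp z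
        (hasFDerivAt_prodMk_right (𝕜 := ℝ) x₂ z)
      exact (h1.comp z h2).hasFDerivWithinAt
    · refine ContinuousLinearMap.opNorm_le_bound _ C.2 fun v => ?_
      refine ((fderiv ℝ f (t₂, x₂, z)).le_of_opNorm_le (hf (t₂, x₂, z) hJ₂ hz.1 hz.2).2 _).trans_eq ?_
      simp
  have hz : ‖z₂ - ζ (t₂, x₂)‖ ≤ ‖z₂ - z₁‖ + ‖ζ (t₂, x₂) - z₁‖ := by
    simpa using norm_sub_le (z₂ - z₁) (ζ (t₂, x₂) - z₁)
  have hz' : ‖z₂ - z₁‖ ≤ dist (t₂, x₂, z₂) (t₁, x₁, z₁) := by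
    simp only [dist_eq_norm, Prod.mk_sub_mk, Prod.norm_mk]
    exact (le_max_right _ _).trans (le_max_right _ _)
  rw [hζ₁] at hG
  have htri : dist (f (t₂, x₂, z₂)) (f (t₁, x₁, z₁)) ≤
      ‖f (t₂, x₂, z₂) - f (t₂, x₂, ζ (t₂, x₂))‖ +
        ‖f (t₂, x₂, ζ (t₂, x₂)) - f (t₁, x₁, z₁)‖ := by
    simpa [dist_eq_norm] using norm_sub_le_norm_sub_add_norm_sub (f (t₂, x₂, z₂))
      (f (t₂, x₂, ζ (t₂, x₂))) (f (t₁, x₁, z₁))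
  set N := dist (t₂, x₂, z₂) (t₁, x₁, z₁)
  have hB0 : (0 : ℝ) ≤ B := B.2
  have hC0 : (0 : ℝ) ≤ C := C.2
  push_cast
  calc _ ≤ _ := htri
    _ ≤ C * (N + 2 * B * N) + C * (1 + 2 * B) * N := by
        refine add_le_add (hV.trans ?_) (hG.trans ?_)
        · gcongr
          refine hz.trans (add_le_add hz' (hζ₂.trans ?_))
          gcongr
        · gcongr
    _ = _ := by ring

end Graph

/-! ### Invariance of graphs under tangent fields -/

section Sign

theorem eq_zero_iff_of_abs_deriv_le {f f' : ℝ → ℝ} {a b C : ℝ} (hab : a ≤ b)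
    (hc : ContinuousOn f (Icc a b)) (hd : ∀ t ∈ Ioo a b, HasDerivAt f (f' t) t)
    (hC : ∀ t ∈ Ioo a b, |f' t| ≤ C * |f t|) : f a = 0 ↔ f b = 0 := by
  refine ⟨eq_zero_of_norm_deriv_le_mul_norm hab hc hd hC, fun h => ?_⟩
  have hmem : ∀ t ∈ Ioo a b, a + b - t ∈ Ioo a b := fun t ht => by
    constructor <;> linarith [ht.1, ht.2]
  have := eq_zero_of_norm_deriv_le_mul_norm (f := fun t => f (a + b - t))
    (f' := fun t => -f' (a + b - t)) (K := C) hab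
    (hc.comp (by fun_prop) fun t ht => by constructor <;> linarith [ht.1, ht.2])
    (fun t ht => by
      have h1 := (hd _ (hmem t ht)).comp t ((hasDerivAt_id t).const_sub (a + b))
      simpa using! h1)
    (fun t ht => by simpa using hC _ (hmem t ht)) (by simpa using h)
  simpa using this

/-- A zero at any time forces `f` to vanish at both ends, so the intermediate value theorem excludes
a change of sign. -/
theorem pos_iff_of_abs_deriv_le {f f' : ℝ → ℝ} {a b C : ℝ} (hab : a ≤ b)
    (hc : ContinuousOn f (Icc a b)) (hd : ∀ t ∈ Ioo a b, HasDerivAt f (f' t) t)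
    (hC : ∀ t ∈ Ioo a b, |f' t| ≤ C * |f t|) : 0 < f a ↔ 0 < f b := by
  have hzero : ∀ c ∈ Icc a b, f c = 0 → f a = 0 ∧ f b = 0 := fun c hcm h =>
    ⟨(eq_zero_iff_of_abs_deriv_le hcm.1 (hc.mono (Icc_subset_Icc_right hcm.2))
        (fun t ht => hd t ⟨ht.1, ht.2.trans_le hcm.2⟩)
        (fun t ht => hC t ⟨ht.1, ht.2.trans_le hcm.2⟩)).2 h,
      (eq_zero_iff_of_abs_deriv_le hcm.2 (hc.mono (Icc_subset_Icc_left hcm.1))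
        (fun t ht => hd t ⟨hcm.1.trans_lt ht.1, ht.2⟩)
        (fun t ht => hC t ⟨hcm.1.trans_lt ht.1, ht.2⟩)).1 h⟩
  constructor
  · intro h
    by_contra! hb
    obtain ⟨c, hcm, h0⟩ := intermediate_value_Icc' hab hc ⟨hb, h.le⟩
    exact h.ne' (hzero c hcm h0).1
  · intro h
    by_contra! ha
    obtain ⟨c, hcm, h0⟩ := intermediate_value_Icc hab hc ⟨ha, h.le⟩
    exact h.ne' (hzero c hcm h0).2

variable {H : Type*} [NormedAddCommGroup H] [NormedSpace ℝ H]

/-- If the field `F` is tangent to the graph of `h`, integral curves do not cross the graph. -/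
theorem IsTrajectory.sign_graph {F : ℝ × H × ℝ → H × ℝ} {T T' : ℝ} {K B : ℝ≥0} {h : ℝ × H → ℝ}
    (hF : LipschitzWith K F) (hT' : T' ≤ T) (hc : ContinuousOn h (Ico 0 T ×ˢ univ))
    (hh : ∀ q ∈ Ioo 0 T ×ˢ (univ : Set H), DifferentiableAt ℝ h q ∧ ‖fderiv ℝ h q‖ ≤ B)
    (htan : ∀ t ∈ Ioo 0 T, ∀ x,
      fderiv ℝ h (t, x) (1, (F (t, x, h (t, x))).1) = (F (t, x, h (t, x))).2)
    {α : ℝ → H × ℝ} (hα : IsTrajectory F T' α) {t : ℝ} (ht : t ∈ Ico 0 T') :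
    ((α 0).2 < h (0, (α 0).1) ↔ (α t).2 < h (t, (α t).1)) ∧
      (h (0, (α 0).1) < (α 0).2 ↔ h (t, (α t).1) < (α t).2) := by
  let f : ℝ → ℝ := fun τ => h (τ, (α τ).1) - (α τ).2
  let f' : ℝ → ℝ := fun τ =>
    fderiv ℝ h (τ, (α τ).1) (1, (F (τ, α τ)).1) - (F (τ, α τ)).2
  have hαc : ContinuousOn α (Icc 0 t) := hα.continuousOn.mono (Icc_subset_Icc_right ht.2.le)
  have hfc : ContinuousOn f (Icc 0 t) := by
    refine ContinuousOn.sub (hc.comp (f := fun τ => (τ, (α τ).1))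
      (continuousOn_id.prodMk hαc.fst) fun τ hτ => ?_) hαc.snd
    exact ⟨⟨hτ.1, (hτ.2.trans_lt ht.2).trans_le hT'⟩, mem_univ _⟩
  have hmem : ∀ τ ∈ Ioo 0 t, τ ∈ Ioo 0 T' ∧ τ ∈ Ioo 0 T := fun τ hτ =>
    ⟨⟨hτ.1, hτ.2.trans ht.2⟩, hτ.1, (hτ.2.trans ht.2).trans_le hT'⟩
  have hfd : ∀ τ ∈ Ioo 0 t, HasDerivAt f (f' τ) τ := by
    intro τ hτ
    have h1 := hα.hasDerivAt (hmem τ hτ).1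
    have h2 := (hh (τ, (α τ).1) ⟨(hmem τ hτ).2, mem_univ _⟩).1.hasFDerivAt
    have h3 : HasDerivAt (fun σ => (α σ).1) (F (τ, α τ)).1 τ :=
      (hasFDerivAt_fst (𝕜 := ℝ) (p := α τ)).comp_hasDerivAt τ h1
    have h4 : HasDerivAt (fun σ => (α σ).2) (F (τ, α τ)).2 τ :=
      (hasFDerivAt_snd (𝕜 := ℝ) (p := α τ)).comp_hasDerivAt τ h1
    exact (h2.comp_hasDerivAt τ ((hasDerivAt_id τ).prodMk h3)).sub h4
  -- Replacing `F (τ, α τ)` by its value `p` at the point of the graph above or below `α τ` would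
  -- make `f' τ` zero, by tangency. The error is controlled by the Lipschitz bound and the vertical
  -- distance `|f τ|`.
  have hfb : ∀ τ ∈ Ioo 0 t, |f' τ| ≤ (B + 1) * K * |f τ| := by
    intro τ hτ
    set p := F (τ, (α τ).1, h (τ, (α τ).1)) with hp
    have h1 := hF.norm_sub_le (τ, α τ) (τ, (α τ).1, h (τ, (α τ).1))
    rw [← hp] at h1
    have h2 : ‖(τ, α τ) - (τ, (α τ).1, h (τ, (α τ).1))‖ = |f τ| := by
      have : (τ, α τ) - (τ, (α τ).1, h (τ, (α τ).1)) = ((0 : ℝ), (0 : H), -f τ) := by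
        simp only [Prod.ext_iff, Prod.fst_sub, Prod.snd_sub, sub_self, f, neg_sub, and_self]
      rw [this]
      simp [Prod.norm_def]
    rw [h2] at h1
    have h3 : f' τ = fderiv ℝ h (τ, (α τ).1) (0, (F (τ, α τ) - p).1) - (F (τ, α τ) - p).2 := by
      have h4 := htan τ (hmem τ hτ).2 (α τ).1
      rw [← hp] at h4
      have h5 : ((0 : ℝ), (F (τ, α τ) - p).1) = (1, (F (τ, α τ)).1) - (1, p.1) := by simp
      rw [h5, map_sub, h4, Prod.snd_sub]
      simp only [f']
      ring
    have h6 : |fderiv ℝ h (τ, (α τ).1) (0, (F (τ, α τ) - p).1)| ≤ B * (K * |f τ|) := by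
      refine ((fderiv ℝ h (τ, (α τ).1)).le_of_opNorm_le
        (hh (τ, (α τ).1) ⟨(hmem τ hτ).2, mem_univ _⟩).2 _).trans ?_
      gcongr
      simpa using (norm_fst_le _).trans h1
    have h7 : |(F (τ, α τ) - p).2| ≤ K * |f τ| := (norm_snd_le _).trans h1
    rw [h3]
    calc _ ≤ _ := abs_sub _ _
      _ ≤ B * (K * |f τ|) + K * |f τ| := add_le_add h6 h7
      _ = _ := by ring
  constructor
  · have := pos_iff_of_abs_deriv_le ht.1 hfc hfd hfb
    simpa only [f, sub_pos] using this
  · have := pos_iff_of_abs_deriv_le (f := fun τ => -f τ) (f' := fun τ => -f' τ) ht.1 hfc.neg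
      (fun τ hτ => (hfd τ hτ).neg) (by simpa using hfb)
    simpa only [f, neg_sub, sub_pos] using this

end Sign

/-! ### Smoothness of inverses -/

section InverseFunction

theorem exists_equiv_of_injective {V : Type*} [NormedAddCommGroup V] [NormedSpace ℝ V]
    [FiniteDimensional ℝ V] (A : V →L[ℝ] V) (hA : Function.Injective A) :
    ∃ A' : V ≃L[ℝ] V, (A' : V →L[ℝ] V) = A :=
  ⟨(LinearEquiv.ofInjectiveEndo (A : V →ₗ[ℝ] V) hA).toContinuousLinearEquiv, by ext; rfl⟩

/-- A left inverse of an injective `C^n` map with invertible derivative is `C^n` on the image. -/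
theorem contDiffAt_leftInvOn {V : Type*} [NormedAddCommGroup V] [NormedSpace ℝ V]
    [FiniteDimensional ℝ V] {F G : V → V} {A : Set V} (hA : IsOpen A) (hG : LeftInvOn G F A)
    {n : ℕ} (hn : 1 ≤ n) {p : V} (hp : p ∈ A) (hF : ContDiffAt ℝ n F p)
    (hinj : Function.Injective (fderiv ℝ F p)) : ContDiffAt ℝ n G (F p) := by
  have : CompleteSpace V := FiniteDimensional.complete ℝ V
  have hn0 : ((n : ℕ) : WithTop ℕ∞) ≠ 0 := by exact_mod_cast (by omega : n ≠ 0)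
  obtain ⟨F', hF'⟩ := exists_equiv_of_injective _ hinj
  have hd : HasFDerivAt F (F' : V →L[ℝ] V) p := by
    rw [hF']; exact (hF.differentiableAt hn0).hasFDerivAt
  have h1 := hF.to_localInverse hd hn0
  have hs := hF.hasStrictFDerivAt' hd hn0
  -- Near `F p` the local inverse takes values in `A`, where `G` undoes `F`; hence the two agree.
  refine h1.congr_of_eventuallyEq ?_
  have h2 : ∀ᶠ q in 𝓝 (F p), hF.localInverse hd hn0 q ∈ A := by
    refine h1.continuousAt.eventually_mem ?_
    rw [hF.localInverse_apply_image hd hn0]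
    exact hA.mem_nhds hp
  filter_upwards [h2, hs.eventually_right_inverse] with q hq hq'
  rw [← hG hq]
  exact congrArg G hq'.symm

end InverseFunction

/-! ### Solutions built from characteristics -/

section Transport

variable {d : ℕ}

theorem deriv_add_fderiv_eq_fderiv_joint {φ : ℝ → Horiz d → ℝ → ℝ} {t l : ℝ} {y : Horiz d}
    (h : DifferentiableAt ℝ (joint φ) (t, y, l)) (v : Horiz d) :
    deriv (fun τ => φ τ y l) t + fderiv ℝ (fun x => φ t x l) y v =
      fderiv ℝ (joint φ) (t, y, l) (1, v, 0) := by
  have h1 : HasDerivAt (fun τ : ℝ => φ τ y l) (fderiv ℝ (joint φ) (t, y, l) (1, 0, 0)) t :=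
    HasFDerivAt.comp_hasDerivAt (f := fun τ : ℝ => (τ, y, l)) t h.hasFDerivAt
      ((hasDerivAt_id t).prodMk (hasDerivAt_const t (y, l)))
  have h2 : HasFDerivAt (fun x => φ t x l) ((fderiv ℝ (joint φ) (t, y, l)).comp
      ((0 : Horiz d →L[ℝ] ℝ).prod ((ContinuousLinearMap.id ℝ (Horiz d)).prod 0))) y :=
    HasFDerivAt.comp (f := fun x => (t, x, l)) y h.hasFDerivAt ((hasFDerivAt_const t y).prodMk
      ((hasFDerivAt_id y).prodMk (hasFDerivAt_const l y)))
  rw [h1.deriv, h2.fderiv]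
  simp only [ContinuousLinearMap.comp_apply, ContinuousLinearMap.prod_apply,
    zero_apply, ContinuousLinearMap.id_apply]
  rw [← map_add]
  simp

theorem deriv_joint_right {φ : ℝ → Horiz d → ℝ → ℝ} {t l : ℝ} {y : Horiz d}
    (h : DifferentiableAt ℝ (joint φ) (t, y, l)) :
    HasDerivAt (φ t y) (fderiv ℝ (joint φ) (t, y, l) (0, 0, 1)) l :=
  HasFDerivAt.comp_hasDerivAt (f := fun l => (t, y, l)) l h.hasFDerivAt
    ((hasDerivAt_const l t).prodMk
    ((hasDerivAt_const l y).prodMk (hasDerivAt_id l)))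

/-- The relation between a function `φ` and the characteristics that issue from the graphs of
`φ₀ (·, l)`: the graph of `φ (t, ·, l)` consists of the points reached at time `t`. -/
structure IsCarried (F : ℝ × Horiz d × ℝ → Horiz d × ℝ) (T : ℝ) (φ₀ : Horiz d → ℝ → ℝ)
    (φ : ℝ → Horiz d → ℝ → ℝ) : Prop where
  apply_trajectory : ∀ α, IsTrajectory F T α → ∀ x, ∀ l ∈ Ioo (0 : ℝ) 1, α 0 = (x, φ₀ x l) →
    ∀ t ∈ Ico 0 T, φ t (α t).1 l = (α t).2
  exists_trajectory : ∀ t ∈ Ico 0 T, ∀ y, ∀ l ∈ Ioo (0 : ℝ) 1,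
    ∃ α x, IsTrajectory F T α ∧ α 0 = (x, φ₀ x l) ∧ α t = (y, φ t y l)

variable {F : ℝ × Horiz d × ℝ → Horiz d × ℝ} {T : ℝ} {K L : ℝ≥0} {φ₀ : Horiz d → ℝ → ℝ}

theorem norm_initial_sub_le
    (hφ₀ : LipschitzOnWith L (fun p : Horiz d × ℝ => φ₀ p.1 p.2) (strip d)) {l : ℝ}
    (hl : l ∈ Ioo (0 : ℝ) 1) (x x' : Horiz d) :
    ‖(x, φ₀ x l) - (x', φ₀ x' l)‖ ≤ (1 + L) * ‖x - x'‖ := by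
  have h1 := hφ₀.norm_sub_le (x := (x, l)) (y := (x', l)) ⟨mem_univ _, hl⟩ ⟨mem_univ _, hl⟩
  have h2 : ‖(x, l) - (x', l)‖ = ‖x - x'‖ := by simp [Prod.norm_def]
  rw [h2] at h1
  have hL : (0 : ℝ) ≤ L := L.2
  rw [Prod.mk_sub_mk, Prod.norm_mk]
  refine max_le ?_ (h1.trans ?_) <;> nlinarith [norm_nonneg (x - x')]

theorem isOpen_strip : IsOpen (strip d) := isOpen_univ.prod isOpen_Ioo

theorem IsTransportSolution.differentiableAt {s : ℕ} (hs : 1 ≤ s) {D : ℝ → Set (Horiz d × ℝ)}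
    {U : ℝ → Horiz d → ℝ → Horiz d} {W : ℝ → Horiz d → ℝ → ℝ} {ψ : ℝ → Horiz d → ℝ → ℝ}
    (hψ : IsTransportSolution s T D U W φ₀ ψ) {t l : ℝ} (ht : t ∈ Ioo 0 T) (y : Horiz d)
    (hl : l ∈ Ioo (0 : ℝ) 1) : DifferentiableAt ℝ (joint ψ) (t, y, l) :=
  (hψ.contDiffOn.differentiableOn (by exact_mod_cast (by omega : s ≠ 0)) (t, y, l)
    ⟨ht, mem_univ _, hl⟩).differentiableAt
    ((isOpen_Ioo.prod isOpen_strip).mem_nhds ⟨ht, mem_univ _, hl⟩)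

/-- The factor `2 * K * T` bounds the relative change of differences of characteristics, and `1 + L`
the distance of their starting points on the graph of `φ₀ (·, l)`; together they make the horizontal
displacement a contraction. Openness of the domain is asked with time replaced by `max q.1 0`, so
that it includes a neighbourhood of the initial time. -/
theorem exists_isCarried (hT : 0 < T) (hF : LipschitzWith K F)
    (hφ₀ : LipschitzOnWith L (fun p : Horiz d × ℝ => φ₀ p.1 p.2) (strip d))
    (hKT : 2 * K * T * (1 + L) ≤ 1 / 2)
    {s : ℕ} (hs : 1 ≤ s) {D : ℝ → Set (Horiz d × ℝ)}
    (hφ₀s : ContDiffOn ℝ s (fun p : Horiz d × ℝ => φ₀ p.1 p.2) (strip d))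
    (hφ₀D : ∀ x, ∀ l ∈ Ioo (0 : ℝ) 1, (x, φ₀ x l) ∈ D 0)
    (hO : IsOpen {q : ℝ × Horiz d × ℝ | q.1 < T ∧ q.2 ∈ D (max q.1 0)})
    (hFs : LocBddContDiffOn s F (spaceTime (Ioo 0 T) D))
    (hinv : ∀ α, IsTrajectory F T α → α 0 ∈ D 0 → ∀ t ∈ Ico 0 T, α t ∈ D t)
    {U : ℝ → Horiz d → ℝ → Horiz d} {W : ℝ → Horiz d → ℝ → ℝ}
    (hUW : ∀ q ∈ spaceTime (Ioo 0 T) D, F q = (joint U q, joint W q)) :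
    ∃ φ, IsTransportSolution s T D U W φ₀ φ ∧ IsCarried F T φ₀ φ := by
  have hs0 : ((s : ℕ) : WithTop ℕ∞) ≠ 0 := by exact_mod_cast (by omega : s ≠ 0)
  have hK0 : (0 : ℝ) ≤ K := K.2
  have hL0 : (0 : ℝ) ≤ L := L.2
  have hKT' : K * T ≤ 1 / 2 := by
    have : 0 ≤ K * T * L := by positivity
    nlinarith
  obtain ⟨Φ, hΦc, hΦ0, hΦ⟩ := exists_flow hF hT hKT'
  have h0T : (0 : ℝ) ∈ Icc 0 T := left_mem_Icc.2 hT.le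
  let χ : ℝ × Horiz d × ℝ → Horiz d × ℝ := fun q => Φ (q.1, q.2.1, φ₀ q.2.1 q.2.2)
  have hχ0 : ∀ t ≤ 0, ∀ p, χ (t, p) = (p.1, φ₀ p.1 p.2) := fun t ht p => hΦ0 t ht _
  have hχtraj : ∀ p : Horiz d × ℝ, IsTrajectory F T fun t => χ (t, p) := fun p =>
    hΦ (p.1, φ₀ p.1 p.2)
  -- smoothness of the characteristics
  let O : Set (ℝ × Horiz d × ℝ) := {q | q.1 < T ∧ q.2 ∈ D (max q.1 0)}
  have hposO : posPart T O = spaceTime (Ioo 0 T) D := by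
    ext ⟨t, p⟩
    simp only [posPart, O, spaceTime, mem_inter_iff, mem_ofPred_eq, mem_prod, mem_univ, and_true]
    constructor
    · rintro ⟨⟨-, h⟩, ht⟩
      rw [max_eq_left ht.1.le] at h
      exact ⟨ht, h⟩
    · rintro ⟨ht, h⟩
      rw [max_eq_left ht.1.le]
      exact ⟨⟨ht.2, h⟩, ht⟩
  have hD0 : IsOpen (D 0) := by
    have : D 0 = (fun p => ((0 : ℝ), p)) ⁻¹' O := by ext p; simp [O, hT]
    rw [this]
    exact hO.preimage (by fun_prop)
  have hflow : IsLocalFlow T O F (D 0) Φ := by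
    refine ⟨hΦc.mono (prod_mono_right (subset_univ _)), fun t ht y hy => ⟨ht, ?_⟩,
      fun t ht y _ => hΦ0 t ht y, fun t ht y _ => (hΦ y).hasDerivAt ht⟩
    rcases le_or_gt t 0 with h | h
    · simpa [max_eq_right h, hΦ0 t h y] using hy
    · simp only [max_eq_left h.le]
      refine hinv _ (hΦ y) ?_ t ⟨h.le, ht⟩
      simpa [hΦ0 0 le_rfl y] using hy
  have hΦs : ContDiffOn ℝ s Φ (Ioo 0 T ×ˢ D 0) :=
    hflow.contDiffOn hO hD0 hT (by rwa [hposO])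
  let A : Set (ℝ × Horiz d × ℝ) := Ioo 0 T ×ˢ strip d
  have hAopen : IsOpen A := isOpen_Ioo.prod isOpen_strip
  have hχs : ContDiffOn ℝ s χ A := by
    refine hΦs.comp (contDiffOn_fst.prodMk (contDiffOn_fst.comp contDiffOn_snd
      (mapsTo_univ _ _) |>.prodMk (hφ₀s.comp contDiffOn_snd fun q hq => hq.2))) ?_
    exact fun q hq => ⟨hq.1, hφ₀D _ _ hq.2.2⟩
  have hχc : ContinuousOn χ (Iio T ×ˢ strip d) := by
    refine hΦc.comp (continuousOn_fst.prodMk ((continuousOn_fst.comp continuousOn_snd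
      (mapsTo_univ _ _)).prodMk (hφ₀s.continuousOn.comp continuousOn_snd fun q hq => hq.2))) ?_
    exact fun q hq => ⟨hq.1, mem_univ _⟩
  -- the horizontal displacement is a contraction
  have hcontr : ∀ t ∈ Ico 0 T, ∀ l ∈ Ioo (0 : ℝ) 1, ∀ x x' : Horiz d,
      ‖((χ (t, x, l)).1 - x) - ((χ (t, x', l)).1 - x')‖ ≤ 1 / 2 * ‖x - x'‖ := by
    intro t ht l hl x x'
    have h1 := (hχtraj (x, l)).norm_sub_sub_le (hχtraj (x', l)) hF hKT'
      (Ico_subset_Icc_self ht) h0T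
    simp only [hχ0 0 le_rfl] at h1
    have h2 : ((χ (t, x, l)).1 - x) - ((χ (t, x', l)).1 - x') =
        ((χ (t, x, l) - χ (t, x', l)) - ((x, φ₀ x l) - (x', φ₀ x' l))).1 := by
      simp only [Prod.fst_sub]; abel
    rw [h2]
    refine (norm_fst_le _).trans (h1.trans ?_)
    calc _ ≤ 2 * K * T * ((1 + L) * ‖x - x'‖) := by
          gcongr; exact norm_initial_sub_le hφ₀ hl x x'
      _ = 2 * K * T * (1 + L) * ‖x - x'‖ := by ring
      _ ≤ _ := by gcongr
  have hexp : ∀ t ∈ Ico 0 T, ∀ l ∈ Ioo (0 : ℝ) 1, ∀ x x' : Horiz d,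
      ‖x - x'‖ ≤ 2 * ‖(χ (t, x, l)).1 - (χ (t, x', l)).1‖ := by
    intro t ht l hl x x'
    have h1 := hcontr t ht l hl x x'
    have h2 : ‖x - x'‖ ≤ ‖(χ (t, x, l)).1 - (χ (t, x', l)).1‖ +
        ‖((χ (t, x, l)).1 - x) - ((χ (t, x', l)).1 - x')‖ := by
      refine le_trans (le_of_eq ?_) (norm_sub_le _ _)
      congr 1; abel
    linarith
  have hsurj : ∀ t ∈ Ico 0 T, ∀ l ∈ Ioo (0 : ℝ) 1, ∀ y : Horiz d, ∃ x, (χ (t, x, l)).1 = y := by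
    intro t ht l hl y
    -- A fixed point of this map is a starting point whose characteristic lies over `y` at time `t`.
    have hc : ContractingWith (1 / 2) fun x => y - ((χ (t, x, l)).1 - x) := by
      refine ⟨by rw [← NNReal.coe_lt_coe]; norm_num, LipschitzWith.of_dist_le_mul fun x x' => ?_⟩
      rw [dist_eq_norm, dist_eq_norm, sub_sub_sub_cancel_left, norm_sub_rev]
      simpa using hcontr t ht l hl x x'
    have hfix := hc.fixedPoint_isFixedPt
    set x := hc.fixedPoint with hx
    refine ⟨x, ?_⟩
    have h1 : y - ((χ (t, x, l)).1 - x) = x := hfix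
    rw [sub_eq_iff_eq_add] at h1
    rw [h1]; abel
  -- The premises are put behind the existential so that the choice of `ξ` yields a total function.
  have hsurj' : ∀ q : ℝ × Horiz d × ℝ, ∃ x, q.1 ∈ Ico 0 T → q.2.2 ∈ Ioo (0 : ℝ) 1 →
      (χ (q.1, x, q.2.2)).1 = q.2.1 := fun q => by
    by_cases h : q.1 ∈ Ico 0 T ∧ q.2.2 ∈ Ioo (0 : ℝ) 1
    · exact (hsurj q.1 h.1 q.2.2 h.2 q.2.1).imp fun x hx _ _ => hx
    · exact ⟨0, fun h1 h2 => absurd ⟨h1, h2⟩ h⟩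
  choose ξ hξ using hsurj'
  have hξχ : ∀ t ∈ Ico 0 T, ∀ l ∈ Ioo (0 : ℝ) 1, ∀ x, ξ (t, (χ (t, x, l)).1, l) = x := by
    intro t ht l hl x
    have h1 := hexp t ht l hl (ξ (t, (χ (t, x, l)).1, l)) x
    rw [hξ (t, (χ (t, x, l)).1, l) ht hl, sub_self, norm_zero, mul_zero] at h1
    exact sub_eq_zero.1 (norm_le_zero_iff.1 h1)
  -- By the expansion bound, `‖x₀ - ξ q‖` is at most twice the horizontal distance between `χ (t,
  -- x₀, l)` and `y`, which tends to zero by continuity of `χ` alone. This reaches the initial time,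
  -- where smoothness is not available.
  have hξc : ContinuousOn ξ (Ico 0 T ×ˢ strip d) := by
    rintro ⟨t₀, y₀, l₀⟩ ⟨ht₀, -, hl₀⟩
    set x₀ := ξ (t₀, y₀, l₀) with hx₀
    rw [ContinuousWithinAt, tendsto_iff_norm_sub_tendsto_zero]
    have h1 : ContinuousWithinAt (fun q : ℝ × Horiz d × ℝ =>
        2 * ‖(χ (q.1, x₀, q.2.2)).1 - q.2.1‖) (Ico 0 T ×ˢ strip d) (t₀, y₀, l₀) := by
      have hmap : MapsTo (fun q : ℝ × Horiz d × ℝ => (q.1, x₀, q.2.2)) (Ico 0 T ×ˢ strip d)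
          (Iio T ×ˢ strip d) := fun q hq => ⟨hq.1.2, mem_univ _, hq.2.2⟩
      have h2 := (hχc.comp (f := fun q : ℝ × Horiz d × ℝ => (q.1, x₀, q.2.2)) (by fun_prop) hmap)
        (t₀, y₀, l₀) ⟨ht₀, mem_univ _, hl₀⟩
      exact (h2.fst.sub (by fun_prop)).norm.const_mul 2
    have h2 : (2 : ℝ) * ‖(χ (t₀, x₀, l₀)).1 - y₀‖ = 0 := by
      rw [hx₀, hξ (t₀, y₀, l₀) ht₀ hl₀]; simp
    have h3 := h1.tendsto
    simp only [h2] at h3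
    refine squeeze_zero' (Eventually.of_forall fun q => norm_nonneg _) ?_ h3
    filter_upwards [self_mem_nhdsWithin] with q hq
    have := hexp q.1 hq.1 q.2.2 hq.2.2 x₀ (ξ q)
    rw [hξ q hq.1 hq.2.2] at this
    rwa [norm_sub_rev]
  -- the flattening map and its inverse
  let Θ : ℝ × Horiz d × ℝ → ℝ × Horiz d × ℝ := fun q => (q.1, (χ q).1, q.2.2)
  let Ψ : ℝ × Horiz d × ℝ → ℝ × Horiz d × ℝ := fun q => (q.1, ξ q, q.2.2)
  have hΨΘ : LeftInvOn Ψ Θ A := fun q hq => by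
    simp only [Ψ, Θ, hξχ q.1 (Ioo_subset_Ico_self hq.1) q.2.2 hq.2.2 q.2.1]
  have hΘΨ : ∀ q ∈ A, Θ (Ψ q) = q := fun q hq => by
    simp only [Ψ, Θ, hξ q (Ioo_subset_Ico_self hq.1) hq.2.2]
  have hΨA : MapsTo Ψ A A := fun q hq => ⟨hq.1, mem_univ _, hq.2.2⟩
  have hΘs : ContDiffOn ℝ s Θ A := by
    have := hχs.fst
    exact contDiffOn_fst.prodMk (this.prodMk (by fun_prop))
  -- The derivative of the displacement has norm at most `1 / 2` and maps a kernel vector `v` to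
  -- `-v`, so `‖v‖ ≤ ‖v‖ / 2`.
  have hinj : ∀ q ∈ A, Function.Injective (fderiv ℝ Θ q) := by
    rintro ⟨t, x, l⟩ hq
    have hχd : DifferentiableAt ℝ (fun q => (χ q).1) (t, x, l) :=
      (hχs.fst.differentiableOn hs0 _ hq).differentiableAt (hAopen.mem_nhds hq)
    have hΘd : HasFDerivAt Θ ((ContinuousLinearMap.fst ℝ ℝ (Horiz d × ℝ)).prod
        ((fderiv ℝ (fun q => (χ q).1) (t, x, l)).prod ((ContinuousLinearMap.snd ℝ (Horiz d) ℝ).comp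
          (ContinuousLinearMap.snd ℝ ℝ (Horiz d × ℝ))))) (t, x, l) :=
      hasFDerivAt_fst.prodMk (hχd.hasFDerivAt.prodMk
        (HasFDerivAt.comp (t, x, l) (hasFDerivAt_snd (p := (x, l))) hasFDerivAt_snd))
    rw [hΘd.fderiv, injective_iff_map_eq_zero]
    rintro ⟨τ, v, μ⟩ h
    simp only [ContinuousLinearMap.prod_apply, ContinuousLinearMap.coe_fst',
      ContinuousLinearMap.comp_apply, ContinuousLinearMap.coe_snd', Prod.mk_eq_zero] at h
    obtain ⟨rfl, h2, rfl⟩ := h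
    have hx : HasFDerivAt (fun x' => (χ (t, x', l)).1 - x')
        ((fderiv ℝ (fun q => (χ q).1) (t, x, l)).comp ((0 : Horiz d →L[ℝ] ℝ).prod
          ((ContinuousLinearMap.id ℝ (Horiz d)).prod 0)) - ContinuousLinearMap.id ℝ (Horiz d)) x :=
      (HasFDerivAt.comp (f := fun x' => (t, x', l)) x hχd.hasFDerivAt
        ((hasFDerivAt_const t x).prodMk
        ((hasFDerivAt_id x).prodMk (hasFDerivAt_const l x)))).sub (hasFDerivAt_id x)
    have hlip : LipschitzWith (1 / 2) fun x' => (χ (t, x', l)).1 - x' :=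
      LipschitzWith.of_dist_le_mul fun x x' => by
        simpa [dist_eq_norm] using hcontr t (Ioo_subset_Ico_self hq.1) l hq.2.2 x x'
    have h3 := ContinuousLinearMap.le_of_opNorm_le _ (hx.le_of_lipschitz hlip) v
    simp only [sub_apply, ContinuousLinearMap.comp_apply,
      ContinuousLinearMap.prod_apply, zero_apply,
      ContinuousLinearMap.id_apply, h2, zero_sub, norm_neg] at h3
    have h4 : ‖v‖ ≤ 1 / 2 * ‖v‖ := by simpa using h3
    have h5 : v = 0 := norm_le_zero_iff.1 (by linarith)
    simp [h5]
  have hΨs : ContDiffOn ℝ s Ψ A := by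
    intro q hq
    have h1 := contDiffAt_leftInvOn hAopen hΨΘ hs (hΨA hq)
      ((hΘs _ (hΨA hq)).contDiffAt (hAopen.mem_nhds (hΨA hq))) (hinj _ (hΨA hq))
    rw [hΘΨ q hq] at h1
    exact h1.contDiffWithinAt
  let φ : ℝ → Horiz d → ℝ → ℝ := fun t y l => (χ (t, ξ (t, y, l), l)).2
  have hφs : ContDiffOn ℝ s (joint φ) A := (hχs.comp hΨs hΨA).snd
  have hcarried : IsCarried F T φ₀ φ := by
    constructor
    · intro α hα x l hl hα0 t ht
      have heq : ∀ t ∈ Icc 0 T, α t = χ (t, x, l) := hα.eqOn (hχtraj (x, l)) hF hKT' h0T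
        (by rw [hα0, hχ0 0 le_rfl])
      simp only [φ, heq t (Ico_subset_Icc_self ht), hξχ t ht l hl x]
    · intro t ht y l hl
      refine ⟨_, ξ (t, y, l), hχtraj (ξ (t, y, l), l), hχ0 0 le_rfl _, ?_⟩
      exact Prod.ext (hξ (t, y, l) ht hl) rfl
  have hφD : ∀ t ∈ Ico 0 T, ∀ y, ∀ l ∈ Ioo (0 : ℝ) 1, (y, φ t y l) ∈ D t := by
    intro t ht y l hl
    obtain ⟨α, x, hα, hα0, hαt⟩ := hcarried.exists_trajectory t ht y l hl
    rw [← hαt]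
    exact hinv α hα (hα0 ▸ hφ₀D x l hl) t ht
  refine ⟨φ, ⟨hφs, fun t ht => hφD t (Ioo_subset_Ico_self ht), ?_, ?_, ?_⟩, hcarried⟩
  · intro t ht y l hl
    have htI := Ioo_subset_Ico_self ht
    obtain ⟨α, x, hα, hα0, hαt⟩ := hcarried.exists_trajectory t htI y l hl
    have hφd : DifferentiableAt ℝ (joint φ) (t, y, l) :=
      (hφs.differentiableOn hs0 (t, y, l) ⟨ht, mem_univ _, hl⟩).differentiableAt
        (hAopen.mem_nhds ⟨ht, mem_univ _, hl⟩)
    have hFt : F (t, α t) = (U t y (φ t y l), W t y (φ t y l)) := by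
      rw [hαt]
      exact hUW _ ⟨ht, hφD t htI y l hl⟩
    have h1 := hα.hasDerivAt ht
    rw [hFt] at h1
    have h2 : HasDerivAt (fun τ => (α τ).1) (U t y (φ t y l)) t :=
      (hasFDerivAt_fst (𝕜 := ℝ) (p := α t)).comp_hasDerivAt t h1
    have h3 : HasDerivAt (fun τ => (α τ).2) (W t y (φ t y l)) t :=
      (hasFDerivAt_snd (𝕜 := ℝ) (p := α t)).comp_hasDerivAt t h1
    have hαt1 : (α t).1 = y := by rw [hαt]
    have hφd' : HasFDerivAt (joint φ) (fderiv ℝ (joint φ) (t, y, l)) (t, (α t).1, l) := by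
      rw [hαt1]; exact hφd.hasFDerivAt
    have h4 : HasDerivAt (fun τ => joint φ (τ, (α τ).1, l))
        (fderiv ℝ (joint φ) (t, y, l) (1, U t y (φ t y l), 0)) t :=
      HasFDerivAt.comp_hasDerivAt (f := fun τ => (τ, (α τ).1, l)) t hφd'
        ((hasDerivAt_id t).prodMk (h2.prodMk (hasDerivAt_const t l)))
    rw [deriv_add_fderiv_eq_fderiv_joint hφd]
    -- The equation is the derivative of the identity `φ τ (α τ).1 l = (α τ).2` along a
    -- characteristic.
    refine h4.unique (h3.congr_of_eventuallyEq ?_)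
    filter_upwards [isOpen_Ioo.mem_nhds ht] with τ hτ
    exact hcarried.apply_trajectory α hα x l hl hα0 τ (Ioo_subset_Ico_self hτ)
  · intro x l hl
    have h1 := hξ (0, x, l) ⟨le_rfl, hT⟩ hl
    rw [hχ0 0 le_rfl] at h1
    simp only at h1
    simp only [φ, hχ0 0 le_rfl, h1]
  · refine (hχc.comp (f := Ψ) (by fun_prop) fun q hq => ?_).snd
    exact ⟨hq.1.2, mem_univ _, hq.2.2⟩

end Transport

/-! ### Uniqueness, monotonicity in the label and the diffeomorphism property -/

section Transport

variable {d : ℕ} {F : ℝ × Horiz d × ℝ → Horiz d × ℝ} {T : ℝ} {K L : ℝ≥0}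
  {φ₀ : Horiz d → ℝ → ℝ} {φ : ℝ → Horiz d → ℝ → ℝ}

/-- Take the characteristic through a point of the graph of `ψ (t, ·, l)`. Its vertical distance `e`
to the graph of `ψ` satisfies a linear differential inequality and vanishes at `t`, hence also at
time `0`. So it starts on the graph of `φ₀ (·, l)`, and `φ` is carried along it too. -/
theorem IsTransportSolution.eq_of_isCarried {s : ℕ} (hs : 1 ≤ s) {D : ℝ → Set (Horiz d × ℝ)}
    {U : ℝ → Horiz d → ℝ → Horiz d} {W : ℝ → Horiz d → ℝ → ℝ} {ψ : ℝ → Horiz d → ℝ → ℝ}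
    (hψ : IsTransportSolution s T D U W φ₀ ψ) (hφ : IsCarried F T φ₀ φ)
    (hF : LipschitzWith K F) (hKT : K * T ≤ 1 / 2)
    (hUW : ∀ q ∈ spaceTime (Ioo 0 T) D, F q = (joint U q, joint W q))
    {t l : ℝ} (ht : t ∈ Ioo 0 T) (y : Horiz d) (hl : l ∈ Ioo (0 : ℝ) 1) :
    ψ t y l = φ t y l := by
  obtain ⟨α, hα, hαt⟩ := exists_isTrajectory hF hKT (Ioo_subset_Icc_self ht) (y, ψ t y l)
  have hαc : ContinuousOn α (Icc 0 t) := hα.continuousOn.mono (Icc_subset_Icc_right ht.2.le)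
  let e : ℝ → ℝ := fun τ => (α τ).2 - ψ τ (α τ).1 l
  have hec : ContinuousOn e (Icc 0 t) := by
    refine hαc.snd.sub (hψ.initial_continuousOn.comp (f := fun τ => (τ, (α τ).1, l))
      (continuousOn_id.prodMk (hαc.fst.prodMk continuousOn_const)) fun τ hτ => ?_)
    exact ⟨⟨hτ.1, hτ.2.trans_lt ht.2⟩, mem_univ _, hl⟩
  have het : e t = 0 := by simp [e, hαt]
  have hmem : ∀ τ ∈ Ioc 0 t, τ ∈ Ioo 0 T := fun τ hτ => ⟨hτ.1, hτ.2.trans_lt ht.2⟩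
  have hzero : EqOn e (fun _ => 0) (Ioc 0 t) := by
    intro a ha
    -- The gradient of `ψ` may blow up as time tends to `0`, so it is bounded on `[a, t]` with `a >
    -- 0` only; time `0` is reached afterwards by continuity of `e`.
    have hgrad : ContinuousOn (fun τ => fderiv ℝ (joint ψ) (τ, (α τ).1, l)) (Icc a t) := by
      refine ((hψ.contDiffOn.continuousOn_fderiv_of_isOpen (isOpen_Ioo.prod isOpen_strip)
        (by exact_mod_cast hs)).comp (f := fun τ => (τ, (α τ).1, l)) ?_ ?_)
      · have := hαc.mono (Icc_subset_Icc_left ha.1.le)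
        exact continuousOn_id.prodMk (this.fst.prodMk continuousOn_const)
      · exact fun τ hτ => ⟨hmem τ ⟨ha.1.trans_le hτ.1, hτ.2⟩, mem_univ _, hl⟩
    obtain ⟨M, hM⟩ := isCompact_Icc.exists_bound_of_continuousOn hgrad
    refine (eq_zero_iff_of_abs_deriv_le (f := e) (C := (1 + M) * K) (f' := fun τ =>
      (F (τ, α τ)).2 - fderiv ℝ (joint ψ) (τ, (α τ).1, l) (1, (F (τ, α τ)).1, 0)) ha.2
      (hec.mono (Icc_subset_Icc_left ha.1.le)) (fun τ hτ => ?_) (fun τ hτ => ?_)).2 het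
    · have hτ' := hmem τ ⟨ha.1.trans hτ.1, hτ.2.le⟩
      have h1 := hα.hasDerivAt hτ'
      have h2 : HasDerivAt (fun τ => (α τ).1) (F (τ, α τ)).1 τ :=
        (hasFDerivAt_fst (𝕜 := ℝ) (p := α τ)).comp_hasDerivAt τ h1
      have h3 : HasDerivAt (fun τ => (α τ).2) (F (τ, α τ)).2 τ :=
        (hasFDerivAt_snd (𝕜 := ℝ) (p := α τ)).comp_hasDerivAt τ h1
      exact h3.sub (HasFDerivAt.comp_hasDerivAt (f := fun τ => (τ, (α τ).1, l)) τ
        (hψ.differentiableAt hs hτ' (α τ).1 hl).hasFDerivAt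
        ((hasDerivAt_id τ).prodMk (h2.prodMk (hasDerivAt_const τ l))))
    · have hτ' := hmem τ ⟨ha.1.trans hτ.1, hτ.2.le⟩
      have heq := hψ.equation τ hτ' (α τ).1 l hl
      rw [deriv_add_fderiv_eq_fderiv_joint (hψ.differentiableAt hs hτ' (α τ).1 hl)] at heq
      have hp : F (τ, (α τ).1, ψ τ (α τ).1 l) =
          (U τ (α τ).1 (ψ τ (α τ).1 l), W τ (α τ).1 (ψ τ (α τ).1 l)) :=
        hUW _ ⟨hτ', hψ.mem_domain τ hτ' (α τ).1 l hl⟩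
      have h1 := hF.norm_sub_le (τ, α τ) (τ, (α τ).1, ψ τ (α τ).1 l)
      set A := fderiv ℝ (joint ψ) (τ, (α τ).1, l) with hA
      have h2 : ‖(τ, α τ) - (τ, (α τ).1, ψ τ (α τ).1 l)‖ = |e τ| := by
        have : (τ, α τ) - (τ, (α τ).1, ψ τ (α τ).1 l) = ((0 : ℝ), (0 : Horiz d), e τ) := by
          simp only [Prod.ext_iff, Prod.fst_sub, Prod.snd_sub, sub_self, e, and_self]
        rw [this]
        simp [Prod.norm_def]
      rw [h2] at h1
      set p := F (τ, (α τ).1, ψ τ (α τ).1 l)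
      have heq' : A (1, p.1, 0) = p.2 := by rw [hp]; exact heq
      have h3 : (F (τ, α τ)).2 - A (1, (F (τ, α τ)).1, 0) =
          (F (τ, α τ) - p).2 - A (0, (F (τ, α τ) - p).1, 0) := by
        have h5 : ((0 : ℝ), (F (τ, α τ) - p).1, (0 : ℝ)) =
            (1, (F (τ, α τ)).1, 0) - (1, p.1, 0) := by simp
        rw [h5, map_sub, heq', Prod.snd_sub]
        ring
      have hM0 := hM τ ⟨hτ.1.le, hτ.2.le⟩
      have h6 : |A (0, (F (τ, α τ) - p).1, 0)| ≤ M * (K * |e τ|) := by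
        refine (A.le_of_opNorm_le hM0 _).trans ?_
        have : 0 ≤ M := (norm_nonneg _).trans hM0
        gcongr
        refine le_trans (le_of_eq ?_) ((norm_fst_le _).trans h1)
        simp [Prod.norm_def]
      have h7 : |(F (τ, α τ) - p).2| ≤ K * |e τ| := (norm_snd_le _).trans h1
      rw [h3]
      calc _ ≤ _ := abs_sub _ _
        _ ≤ K * |e τ| + M * (K * |e τ|) := add_le_add h7 h6
        _ = _ := by ring
  have he0 : e 0 = 0 := by
    refine (hzero.of_subset_closure hec continuousOn_const Ioc_subset_Icc_self ?_)
      (left_mem_Icc.2 ht.1.le)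
    rw [closure_Ioc ht.1.ne]
  have hα0 : α 0 = ((α 0).1, φ₀ (α 0).1 l) := by
    refine Prod.ext rfl ?_
    have := sub_eq_zero.1 he0
    rw [hψ.initial _ l hl] at this
    exact this
  have := hφ.apply_trajectory α hα _ l hl hα0 t (Ioo_subset_Ico_self ht)
  rw [hαt] at this
  exact this.symm

/-- Two characteristics that reach `(y, φ t y l)` and `(y, φ t y l')` differ by the vertical vector
`(0, δ)` at time `t`, and by the same up to `2 * K * T * |δ|` at time `0`. Moving the starting point
from `x` to `x'` costs `L` times the horizontal error, so the lower bound on increments of `φ₀ x'`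
gives `ε * (l' - l) - δ ≤ |δ| / 2`. No derivative of `φ` is estimated. -/
theorem IsCarried.increment_ge (hφ : IsCarried F T φ₀ φ) (hF : LipschitzWith K F)
    (hφ₀ : LipschitzOnWith L (fun p : Horiz d × ℝ => φ₀ p.1 p.2) (strip d))
    (hKT : 2 * K * T * (1 + L) ≤ 1 / 2) {ε : ℝ} (hε : 0 < ε)
    (hinc : ∀ x, ∀ l ∈ Ioo (0 : ℝ) 1, ∀ l' ∈ Ioo (0 : ℝ) 1, l < l' →
      ε * (l' - l) ≤ φ₀ x l' - φ₀ x l)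
    {t : ℝ} (ht : t ∈ Ico 0 T) (y : Horiz d) {l l' : ℝ} (hl : l ∈ Ioo (0 : ℝ) 1)
    (hl' : l' ∈ Ioo (0 : ℝ) 1) (hll' : l < l') :
    ε / 2 * (l' - l) ≤ φ t y l' - φ t y l := by
  have hT : 0 ≤ T := ht.1.trans ht.2.le
  have hK0 : (0 : ℝ) ≤ K := K.2
  have hL0 : (0 : ℝ) ≤ L := L.2
  have hKT' : K * T ≤ 1 / 2 := by
    have : 0 ≤ K * T * L := by positivity
    have : 0 ≤ K * T := by positivity
    nlinarith
  obtain ⟨α, x, hα, hα0, hαt⟩ := hφ.exists_trajectory t ht y l hl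
  obtain ⟨β, x', hβ, hβ0, hβt⟩ := hφ.exists_trajectory t ht y l' hl'
  set δ := φ t y l' - φ t y l with hδ
  have h1 := hβ.norm_sub_sub_le hα hF hKT' (left_mem_Icc.2 hT) (Ico_subset_Icc_self ht)
  have h2 : β t - α t = (0, δ) := by rw [hαt, hβt]; simp [hδ]
  have h3 : ‖β t - α t‖ = |δ| := by rw [h2]; simp [Prod.norm_def]
  rw [h3, h2, hα0, hβ0] at h1
  have h4 : ‖x' - x‖ ≤ 2 * K * T * |δ| := by
    refine le_trans (le_of_eq ?_) ((norm_fst_le _).trans h1); simp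
  have h5 : |(φ₀ x' l' - φ₀ x l) - δ| ≤ 2 * K * T * |δ| := (norm_snd_le _).trans h1
  have h6 : |φ₀ x' l - φ₀ x l| ≤ L * ‖x' - x‖ := by
    have := hφ₀.norm_sub_le (x := (x', l)) (y := (x, l)) ⟨mem_univ _, hl⟩ ⟨mem_univ _, hl⟩
    simpa [Prod.norm_def] using this
  have h7 := hinc x' l hl l' hl' hll'
  have h8 : ε * (l' - l) - δ ≤ 1 / 2 * |δ| := by
    have a1 := (abs_le.1 h5).2
    have a2 := (abs_le.1 h6).1
    have a3 : L * ‖x' - x‖ ≤ L * (2 * K * T * |δ|) := by gcongr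
    have a4 : 2 * K * T * |δ| + L * (2 * K * T * |δ|) = 2 * K * T * (1 + L) * |δ| := by ring
    have a5 : 2 * K * T * (1 + L) * |δ| ≤ 1 / 2 * |δ| := by gcongr
    linarith
  have h9 : 0 < ε * (l' - l) := mul_pos hε (sub_pos.2 hll')
  rcases le_or_gt 0 δ with h | h
  · rw [abs_of_nonneg h] at h8; nlinarith
  · rw [abs_of_neg h] at h8; linarith

theorem deriv_pos_of_increment_ge {f : ℝ → ℝ} {c f' l : ℝ} (hc : 0 < c)
    (hf : ∀ l ∈ Ioo (0 : ℝ) 1, ∀ l' ∈ Ioo (0 : ℝ) 1, l < l' → c * (l' - l) ≤ f l' - f l)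
    (hl : l ∈ Ioo (0 : ℝ) 1) (hd : HasDerivAt f f' l) : 0 < f' := by
  have hmono : MonotoneOn (fun l => f l - c * l) (Ioo 0 1) := by
    intro a ha b hb hab
    rcases hab.eq_or_lt with rfl | h
    · exact le_rfl
    · have := hf a ha b hb h
      simp only
      linarith
  have h1 := hmono.derivWithin_nonneg (x := l)
  have h2 : HasDerivAt (fun l => f l - c * l) (f' - c) l := by
    simpa using! hd.sub ((hasDerivAt_id l).const_mul c)
  rw [h2.hasDerivWithinAt.derivWithin (isOpen_Ioo.uniqueDiffWithinAt hl)] at h1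
  linarith

theorem increment_ge_of_deriv_ge {f : ℝ → ℝ} {ε : ℝ} (hd : DifferentiableOn ℝ f (Ioo 0 1))
    (hf : ∀ l ∈ Ioo (0 : ℝ) 1, ε ≤ deriv f l) {l l' : ℝ} (hl : l ∈ Ioo (0 : ℝ) 1)
    (hl' : l' ∈ Ioo (0 : ℝ) 1) (hll' : l < l') : ε * (l' - l) ≤ f l' - f l :=
  (convex_Ioo 0 1).mul_sub_le_image_sub_of_le_deriv hd.continuousOn
    (by rwa [interior_Ioo]) (by simpa [interior_Ioo] using hf) l hl l' hl' hll'.le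

/-- The map is the identity plus a rank-one map with range in the last axis, that is, a
transvection. -/
theorem det_prod_fst {H : Type*} [NormedAddCommGroup H] [NormedSpace ℝ H] [FiniteDimensional ℝ H]
    (a : H × ℝ →L[ℝ] ℝ) : ((ContinuousLinearMap.fst ℝ H ℝ).prod a).det = a (0, 1) := by
  have h : (((ContinuousLinearMap.fst ℝ H ℝ).prod a : H × ℝ →L[ℝ] H × ℝ) :
      H × ℝ →ₗ[ℝ] H × ℝ) = LinearMap.transvection
        ((a : H × ℝ →ₗ[ℝ] ℝ) - LinearMap.snd ℝ H ℝ) ((0 : H), (1 : ℝ)) := by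
    refine LinearMap.ext fun p => ?_
    rw [LinearMap.transvection.apply]
    ext <;> simp
  rw [ContinuousLinearMap.det, h, LinearMap.transvection.det]
  simp

theorem isOrientedDiffeoOn_of_increment_ge {s : ℕ} (hs : 1 ≤ s) {f : Horiz d → ℝ → ℝ}
    {B : Set (Horiz d × ℝ)} {c : ℝ} (hc : 0 < c)
    (hf : ContDiffOn ℝ s (fun p : Horiz d × ℝ => f p.1 p.2) (strip d))
    (hinc : ∀ x, ∀ l ∈ Ioo (0 : ℝ) 1, ∀ l' ∈ Ioo (0 : ℝ) 1, l < l' → c * (l' - l) ≤ f x l' - f x l)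
    (hmaps : ∀ x, ∀ l ∈ Ioo (0 : ℝ) 1, (x, f x l) ∈ B)
    (hsurj : ∀ p ∈ B, ∃ l ∈ Ioo (0 : ℝ) 1, f p.1 l = p.2) :
    IsOrientedDiffeoOn s (fun p : Horiz d × ℝ => (p.1, f p.1 p.2)) (strip d) B := by
  set G : Horiz d × ℝ → Horiz d × ℝ := fun p => (p.1, f p.1 p.2) with hG
  have hs0 : ((s : ℕ) : WithTop ℕ∞) ≠ 0 := by exact_mod_cast (by omega : s ≠ 0)
  have hinj : InjOn G (strip d) := by
    rintro ⟨x, l⟩ hl ⟨x', l'⟩ hl' h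
    simp only [hG, Prod.mk.injEq] at h
    obtain ⟨rfl, h⟩ := h
    have : l = l' := by
      rcases lt_trichotomy l l' with h' | h' | h'
      · have := hinc x l hl.2 l' hl'.2 h'
        nlinarith
      · exact h'
      · have := hinc x l' hl'.2 l hl.2 h'
        nlinarith
    rw [this]
  have hbij : BijOn G (strip d) B := by
    refine ⟨fun p hp => hmaps p.1 p.2 hp.2, hinj, fun p hp => ?_⟩
    obtain ⟨l, hl, h⟩ := hsurj p hp
    exact ⟨(p.1, l), ⟨mem_univ _, hl⟩, Prod.ext rfl h⟩
  have hGs : ContDiffOn ℝ s G (strip d) := contDiffOn_fst.prodMk hf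
  have hfd : ∀ p ∈ strip d, DifferentiableAt ℝ (fun p : Horiz d × ℝ => f p.1 p.2) p := fun p hp =>
    (hf.differentiableOn hs0 p hp).differentiableAt (isOpen_strip.mem_nhds hp)
  have hderiv : ∀ p ∈ strip d, fderiv ℝ G p = (ContinuousLinearMap.fst ℝ (Horiz d) ℝ).prod
      (fderiv ℝ (fun p : Horiz d × ℝ => f p.1 p.2) p) := fun p hp =>
    (hasFDerivAt_fst.prodMk (hfd p hp).hasFDerivAt).fderiv
  have hpos : ∀ p ∈ strip d, 0 < fderiv ℝ (fun p : Horiz d × ℝ => f p.1 p.2) p (0, 1) := by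
    intro p hp
    refine deriv_pos_of_increment_ge hc (hinc p.1) hp.2 ?_
    exact HasFDerivAt.comp_hasDerivAt (f := fun l => (p.1, l)) p.2 (hfd p hp).hasFDerivAt
      ((hasDerivAt_const p.2 p.1).prodMk (hasDerivAt_id p.2))
  refine ⟨hbij, hGs, ⟨Function.invFunOn G (strip d), hbij.invOn_invFunOn, ?_⟩, fun p hp => ?_⟩
  · intro q hq
    obtain ⟨p, hp, rfl⟩ := hbij.surjOn hq
    refine (contDiffAt_leftInvOn isOpen_strip hbij.invOn_invFunOn.1 hs hp
      ((hGs p hp).contDiffAt (isOpen_strip.mem_nhds hp)) ?_).contDiffWithinAt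
    rw [hderiv p hp, injective_iff_map_eq_zero]
    rintro ⟨v, μ⟩ h
    simp only [ContinuousLinearMap.prod_apply, ContinuousLinearMap.coe_fst',
      Prod.mk_eq_zero] at h
    obtain ⟨rfl, h⟩ := h
    have h1 : ((0 : Horiz d), μ) = μ • ((0 : Horiz d), (1 : ℝ)) := by simp
    rw [h1, map_smul, smul_eq_mul, mul_eq_zero, or_iff_left (hpos p hp).ne'] at h
    rw [h]; rfl
  · rw [hderiv p hp, det_prod_fst]
    exact hpos p hp

end Transport

theorem LocBddContDiffOn.mono_set {V W : Type*} [NormedAddCommGroup V] [NormedSpace ℝ V]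
    [NormedAddCommGroup W] [NormedSpace ℝ W] {n : ℕ} {f : V → W} {S S' : Set V} (hS : IsOpen S)
    (hS' : IsOpen S') (h : S' ⊆ S) (hf : LocBddContDiffOn n f S) : LocBddContDiffOn n f S' := by
  refine ⟨hf.1.mono h, fun R => (hf.2 R).imp fun C hC k hk p hp hpR => ?_⟩
  rw [iteratedFDerivWithin_of_isOpen k hS' hp, ← iteratedFDerivWithin_of_isOpen k hS (h hp)]
  exact hC k hk p (h hp) hpR

/-! ### The fluid domain and its invariance -/

section FluidDomain

variable {d : ℕ} {T : ℝ} {zb : Horiz d → ℝ} {η : ℝ → Horiz d → ℝ}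

/-- Only continuity of `η` down to time `0` is available there; freezing the domain at negative
times makes time `0` interior. -/
theorem isOpen_extended_fluidDomain (hzb : Continuous zb)
    (hη : ContinuousOn (fun q : ℝ × Horiz d => η q.1 q.2) (Ico 0 T ×ˢ univ)) {T' : ℝ}
    (hT : 0 < T) (hT' : T' ≤ T) :
    IsOpen {q : ℝ × Horiz d × ℝ | q.1 < T' ∧ q.2 ∈ fluidDomain zb η (max q.1 0)} := by
  have h1 : ContinuousOn (fun q : ℝ × Horiz d × ℝ =>
      (q.2.2 - zb q.2.1, η (max q.1 0) q.2.1 - q.2.2)) {q | q.1 < T'} := by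
    refine ContinuousOn.prodMk (by fun_prop) (ContinuousOn.sub ?_ (by fun_prop))
    refine hη.comp (f := fun q : ℝ × Horiz d × ℝ => (max q.1 0, q.2.1)) (by fun_prop)
      fun q (hq : q.1 < T') => ⟨⟨le_max_right _ _, max_lt (hq.trans_le hT') hT⟩, mem_univ _⟩
  have h2 := h1.isOpen_inter_preimage (isOpen_lt continuous_fst continuous_const)
    ((isOpen_Ioi (a := (0 : ℝ))).prod (isOpen_Ioi (a := (0 : ℝ))))
  convert h2 using 1
  ext q
  simp [fluidDomain]

theorem isOpen_spaceTime_fluidDomain (hzb : Continuous zb)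
    (hη : ContinuousOn (fun q : ℝ × Horiz d => η q.1 q.2) (Ico 0 T ×ˢ univ)) (hT : 0 < T) {T' : ℝ}
    (hT' : T' ≤ T) : IsOpen (spaceTime (Ioo 0 T') (fluidDomain zb η)) := by
  have h := (isOpen_extended_fluidDomain hzb hη hT hT').inter
    (isOpen_lt (continuous_const (y := (0 : ℝ))) continuous_fst)
  convert h using 1
  ext ⟨t, p⟩
  simp only [spaceTime, mem_ofPred_eq, mem_inter_iff]
  constructor
  · rintro ⟨ht, hp⟩
    rw [max_eq_left ht.1.le]
    exact ⟨⟨ht.2, hp⟩, ht.1⟩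
  · rintro ⟨⟨h1, h2⟩, h3⟩
    rw [max_eq_left h3.le] at h2
    exact ⟨⟨h3, h1⟩, h2⟩

theorem lipschitzOnWith_spaceTime {W : Type*} [NormedAddCommGroup W] [NormedSpace ℝ W] {s : ℕ}
    (hs : 1 ≤ s) (hT : 0 < T) (hzb : CbOn s zb univ)
    (hηc : ContinuousOn (fun q : ℝ × Horiz d => η q.1 q.2) (Ico 0 T ×ˢ univ))
    (hη : CbOn s (fun q : ℝ × Horiz d => η q.1 q.2) (Ioo 0 T ×ˢ univ))
    (hdepth : ∀ t ∈ Ioo 0 T, ∀ x, zb x < η t x) {D : ℝ → Set (Horiz d × ℝ)}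
    (hD : D = fluidDomain zb η ∨ D = fun _ => univ) {f : ℝ × Horiz d × ℝ → W}
    (hf : CbOn s f (spaceTime (Ioo 0 T) D)) :
    ∃ K : ℝ≥0, LipschitzOnWith K f (spaceTime (Ioo 0 T) D) := by
  obtain ⟨B₁, hB₁⟩ := hzb.exists_norm_fderiv_le hs isOpen_univ
  obtain ⟨B₂, hB₂⟩ := hη.exists_norm_fderiv_le hs (isOpen_Ioo.prod isOpen_univ)
  rcases hD with rfl | rfl
  · obtain ⟨C, hC⟩ := hf.exists_norm_fderiv_le hs
      (isOpen_spaceTime_fluidDomain (continuousOn_univ.1 hzb.1.continuousOn) hηc hT le_rfl)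
    have hb : ∀ x, DifferentiableAt ℝ zb x ∧ ‖fderiv ℝ zb x‖ ≤ (B₁ ⊔ B₂ : ℝ≥0) := fun x =>
      ⟨(hB₁ x (mem_univ x)).1, (hB₁ x (mem_univ x)).2.trans (NNReal.coe_le_coe.2 le_sup_left)⟩
    exact ⟨_, lipschitzOnWith_between_graphs (convex_Ioo 0 T) hb
      (fun q hq => ⟨(hB₂ q hq).1, (hB₂ q hq).2.trans (NNReal.coe_le_coe.2 le_sup_right)⟩)
      (fun q hq => hdepth q.1 hq.1 q.2) (fun q h1 h2 h3 => hC q ⟨h1, h2, h3⟩)⟩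
  · have hset : spaceTime (Ioo 0 T) (fun _ => (univ : Set (Horiz d × ℝ))) = Ioo 0 T ×ˢ univ := by
      ext; simp [spaceTime]
    rw [hset] at hf ⊢
    obtain ⟨C, hC⟩ := hf.exists_norm_fderiv_le hs (isOpen_Ioo.prod isOpen_univ)
    exact ⟨C, lipschitzOnWith_of_convex ((convex_Ioo 0 T).prod convex_univ) hC⟩

/-- Integral curves of a Lipschitz field that satisfies the kinematic conditions at bottom and
surface stay in the fluid domain, forward and backward in time. -/
theorem IsTrajectory.mem_fluidDomain_iff {s : ℕ} (hs : 1 ≤ s) {g : ℝ} {η₀ : Horiz d → ℝ}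
    {u₀ : Horiz d → ℝ → Horiz d} {u : ℝ → Horiz d → ℝ → Horiz d} {w : ℝ → Horiz d → ℝ → ℝ}
    (hsol : IsSolution g T zb η₀ u₀ η u w) (hzb : CbOn s zb univ)
    (hη : CbOn s (fun q : ℝ × Horiz d => η q.1 q.2) (Ioo 0 T ×ˢ univ))
    (hdepth : ∀ t ∈ Ioo 0 T, ∀ x, zb x < η t x) {F : ℝ × Horiz d × ℝ → Horiz d × ℝ} {K : ℝ≥0}
    (hF : LipschitzWith K F)
    (hFu : ∀ q ∈ spaceTime (Ioo 0 T) (fluidDomain zb η), F q = (joint u q, joint w q))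
    {T' : ℝ} (hT' : T' ≤ T) {α : ℝ → Horiz d × ℝ} (hα : IsTrajectory F T' α) {t : ℝ}
    (ht : t ∈ Ico 0 T') : α 0 ∈ fluidDomain zb η 0 ↔ α t ∈ fluidDomain zb η t := by
  obtain ⟨B₁, hB₁⟩ := hzb.exists_norm_fderiv_le hs isOpen_univ
  obtain ⟨B₂, hB₂⟩ := hη.exists_norm_fderiv_le hs (isOpen_Ioo.prod isOpen_univ)
  -- `F` is known to equal `(u, w)` inside the fluid; continuity of both sides extends this to
  -- bottom and surface, where the kinematic conditions hold.
  have hclosed : ∀ t ∈ Ioo 0 T, ∀ x, ∀ z ∈ Icc (zb x) (η t x), F (t, x, z) = (u t x z, w t x z) := by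
    intro t ht x
    have h1 : EqOn (fun z => F (t, x, z)) (fun z => (u t x z, w t x z)) (Ioo (zb x) (η t x)) :=
      fun z hz => hFu (t, x, z) ⟨ht, hz⟩
    have hmap : MapsTo (fun z => (t, x, z)) (Icc (zb x) (η t x))
        (spaceTime (Ioo 0 T) (closedFluidDomain zb η)) := fun z hz => ⟨ht, hz⟩
    refine h1.of_subset_closure (hF.continuous.comp (by fun_prop)).continuousOn
      ((hsol.continuousOn_u.comp (by fun_prop) hmap).prodMk
        (hsol.continuousOn_w.comp (by fun_prop) hmap)) Ioo_subset_Icc_self ?_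
    rw [closure_Ioo (hdepth t ht x).ne]
  have hsurf := IsTrajectory.sign_graph (h := fun q : ℝ × Horiz d => η q.1 q.2) hF hT'
    hsol.initial_η_continuousOn hB₂ (fun t ht x => by
      rw [hclosed t ht x _ ⟨(hdepth t ht x).le, le_rfl⟩]
      have hd := (hB₂ (t, x) ⟨ht, mem_univ _⟩).1
      have h1 : HasDerivAt (fun τ => η τ x)
          (fderiv ℝ (fun q : ℝ × Horiz d => η q.1 q.2) (t, x) (1, 0)) t :=
        HasFDerivAt.comp_hasDerivAt (f := fun τ => (τ, x)) t hd.hasFDerivAt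
          ((hasDerivAt_id t).prodMk (hasDerivAt_const t x))
      have h2 : HasFDerivAt (η t) ((fderiv ℝ (fun q : ℝ × Horiz d => η q.1 q.2) (t, x)).comp
          (ContinuousLinearMap.inr ℝ ℝ (Horiz d))) x :=
        HasFDerivAt.comp (f := fun x => (t, x)) x hd.hasFDerivAt (hasFDerivAt_prodMk_right t x)
      have h3 := hsol.surface t ht x
      rw [h1.deriv, h2.fderiv, ContinuousLinearMap.comp_apply, ← map_add] at h3
      simpa [sub_eq_zero] using h3) hα ht
  have hbot := IsTrajectory.sign_graph (h := fun q : ℝ × Horiz d => zb q.2) hF hT' (B := B₁)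
    (((continuousOn_univ.1 hzb.1.continuousOn)).comp continuous_snd).continuousOn (fun q _ => by
      have hd := (hB₁ q.2 (mem_univ _))
      have h1 : HasFDerivAt (fun q : ℝ × Horiz d => zb q.2)
          ((fderiv ℝ zb q.2).comp (ContinuousLinearMap.snd ℝ ℝ (Horiz d))) q :=
        hd.1.hasFDerivAt.comp q hasFDerivAt_snd
      refine ⟨h1.differentiableAt, ?_⟩
      rw [h1.fderiv]
      refine (ContinuousLinearMap.opNorm_comp_le _ _).trans ?_
      calc _ ≤ (B₁ : ℝ) * 1 := mul_le_mul hd.2 (ContinuousLinearMap.norm_snd_le ..)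
            (norm_nonneg _) B₁.2
        _ = B₁ := mul_one _) (fun t ht x => by
      rw [hclosed t ht x _ ⟨le_rfl, (hdepth t ht x).le⟩]
      have h1 : HasFDerivAt (fun q : ℝ × Horiz d => zb q.2)
          ((fderiv ℝ zb x).comp (ContinuousLinearMap.snd ℝ ℝ (Horiz d))) (t, x) :=
        HasFDerivAt.comp (t, x) (hB₁ x (mem_univ _)).1.hasFDerivAt hasFDerivAt_snd
      rw [h1.fderiv]
      exact sub_eq_zero.1 (hsol.bottom t ht x)) hα ht
  exact and_congr hbot.2 hsurf.1

end FluidDomain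

theorem exists_mem_Ioo_eq_of_tendsto {f : ℝ → ℝ} {a b z : ℝ} (hf : ContinuousOn f (Ioo 0 1))
    (ha : Tendsto f (𝓝[>] 0) (𝓝 a)) (hb : Tendsto f (𝓝[<] 1) (𝓝 b)) (haz : a < z) (hzb : z < b) :
    ∃ l ∈ Ioo (0 : ℝ) 1, f l = z := by
  obtain ⟨l, hl, hlI⟩ := ((ha.eventually_lt_const haz).and (Ioo_mem_nhdsGT zero_lt_one)).exists
  obtain ⟨l', hl', hlI'⟩ := ((hb.eventually_const_lt hzb).and (Ioo_mem_nhdsLT zero_lt_one)).exists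
  exact isPreconnected_Ioo.intermediate_value hlI hlI' hf ⟨hl.le, hl'.le⟩

theorem mem_Ioo_of_strictMonoOn_of_tendsto {f : ℝ → ℝ} {a b l : ℝ} (hf : StrictMonoOn f (Ioo 0 1))
    (ha : Tendsto f (𝓝[>] 0) (𝓝 a)) (hb : Tendsto f (𝓝[<] 1) (𝓝 b)) (hl : l ∈ Ioo (0 : ℝ) 1) :
    f l ∈ Ioo a b := by
  have h1 : l / 2 ∈ Ioo (0 : ℝ) 1 := by constructor <;> linarith [hl.1, hl.2]
  have h2 : (l + 1) / 2 ∈ Ioo (0 : ℝ) 1 := by constructor <;> linarith [hl.1, hl.2]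
  constructor
  · refine lt_of_le_of_lt (le_of_tendsto ha ?_) (hf h1 hl (by linarith [hl.1]))
    filter_upwards [Ioo_mem_nhdsGT h1.1] with x hx
    exact (hf ⟨hx.1, hx.2.trans h1.2⟩ h1 hx.2).le
  · refine lt_of_lt_of_le (hf hl h2 (by linarith [hl.2])) (ge_of_tendsto hb ?_)
    filter_upwards [Ioo_mem_nhdsLT h2.2] with x hx
    exact (hf h2 ⟨h2.1.trans hx.1, hx.2⟩ hx.1).le

end HydrostaticEuler

/-! ### The main theorem -/

open HydrostaticEuler

theorem mainTheorem7 {d s : ℕ} (hs : 1 ≤ s) (g : ℝ) {T : ℝ} (hT : 0 < T)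
    {zb : HydrostaticEuler.Horiz d → ℝ} (hzb : HydrostaticEuler.CbOn s zb Set.univ)
    {η₀ : HydrostaticEuler.Horiz d → ℝ}
    {u₀ : HydrostaticEuler.Horiz d → ℝ → HydrostaticEuler.Horiz d}
    {η : ℝ → HydrostaticEuler.Horiz d → ℝ}
    {u : ℝ → HydrostaticEuler.Horiz d → ℝ → HydrostaticEuler.Horiz d}
    {w : ℝ → HydrostaticEuler.Horiz d → ℝ → ℝ}
    (hsol : HydrostaticEuler.IsSolution g T zb η₀ u₀ η u w)
    -- the water depth is positive
    (hdepth : ∀ t ∈ Set.Ioo 0 T, ∀ x, zb x < η t x)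
    (hη : HydrostaticEuler.CbOn s (fun q : ℝ × HydrostaticEuler.Horiz d => η q.1 q.2)
      (Set.Ioo 0 T ×ˢ Set.univ))
    (hu : HydrostaticEuler.CbOn s (HydrostaticEuler.joint u)
      (HydrostaticEuler.spaceTime (Set.Ioo 0 T) (HydrostaticEuler.fluidDomain zb η)))
    (hw : HydrostaticEuler.CbOn s (HydrostaticEuler.joint w)
      (HydrostaticEuler.spaceTime (Set.Ioo 0 T) (HydrostaticEuler.fluidDomain zb η)))
    -- the transport equation is posed either in the fluid domain, with the fields `u`, `w`
    -- themselves, or in the whole space, with extensions `U`, `W` of `u`, `w`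
    {D : ℝ → Set (HydrostaticEuler.Horiz d × ℝ)}
    (hD : D = HydrostaticEuler.fluidDomain zb η ∨ D = fun _ => Set.univ)
    {U : ℝ → HydrostaticEuler.Horiz d → ℝ → HydrostaticEuler.Horiz d}
    {W : ℝ → HydrostaticEuler.Horiz d → ℝ → ℝ}
    (hU : HydrostaticEuler.CbOn s (HydrostaticEuler.joint U)
      (HydrostaticEuler.spaceTime (Set.Ioo 0 T) D))
    (hW : HydrostaticEuler.CbOn s (HydrostaticEuler.joint W)
      (HydrostaticEuler.spaceTime (Set.Ioo 0 T) D))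
    (hUu : Set.EqOn (HydrostaticEuler.joint U) (HydrostaticEuler.joint u)
      (HydrostaticEuler.spaceTime (Set.Ioo 0 T) (HydrostaticEuler.fluidDomain zb η)))
    (hWw : Set.EqOn (HydrostaticEuler.joint W) (HydrostaticEuler.joint w)
      (HydrostaticEuler.spaceTime (Set.Ioo 0 T) (HydrostaticEuler.fluidDomain zb η)))
    {φ₀ : HydrostaticEuler.Horiz d → ℝ → ℝ}
    (hφ₀ : HydrostaticEuler.CbOn s (fun p : HydrostaticEuler.Horiz d × ℝ => φ₀ p.1 p.2)
      (HydrostaticEuler.strip d))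
    (hφ₀D : ∀ x, ∀ l ∈ Set.Ioo (0 : ℝ) 1, (x, φ₀ x l) ∈ D 0) :
    ∃ T' : ℝ, 0 < T' ∧ T' ≤ T ∧ ∃ φ : ℝ → HydrostaticEuler.Horiz d → ℝ → ℝ,
      HydrostaticEuler.IsTransportSolution s T' D U W φ₀ φ ∧
      (∀ ψ : ℝ → HydrostaticEuler.Horiz d → ℝ → ℝ,
        HydrostaticEuler.IsTransportSolution s T' D U W φ₀ ψ →
        ∀ t ∈ Set.Ioo 0 T', ∀ x, ∀ l ∈ Set.Ioo (0 : ℝ) 1, ψ t x l = φ t x l) ∧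
      ((∃ ε : ℝ, 0 < ε ∧ ∀ x, ∀ l ∈ Set.Ioo (0 : ℝ) 1, ε ≤ deriv (φ₀ x) l) →
        (∀ t ∈ Set.Ioo 0 T', ∀ x, ∀ l ∈ Set.Ioo (0 : ℝ) 1, 0 < deriv (φ t x) l) ∧
        ((∀ x, Filter.Tendsto (φ₀ x) (nhdsWithin 0 (Set.Ioi 0)) (nhds (zb x)) ∧
            Filter.Tendsto (φ₀ x) (nhdsWithin 1 (Set.Iio 1)) (nhds (η₀ x))) →
          ∀ t ∈ Set.Ioo 0 T',
            HydrostaticEuler.IsOrientedDiffeoOn s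
              (fun p : HydrostaticEuler.Horiz d × ℝ => (p.1, φ t p.1 p.2))
              (HydrostaticEuler.strip d) (HydrostaticEuler.fluidDomain zb η t))) := by
  have hs0 : ((s : ℕ) : WithTop ℕ∞) ≠ 0 := by exact_mod_cast (by omega : s ≠ 0)
  have hzbc : Continuous zb := (continuousOn_univ.1 hzb.1.continuousOn)
  have hηc := hsol.initial_η_continuousOn
  obtain ⟨K₁, hK₁⟩ := lipschitzOnWith_spaceTime hs hT hzb hηc hη hdepth hD hU
  obtain ⟨K₂, hK₂⟩ := lipschitzOnWith_spaceTime hs hT hzb hηc hη hdepth hD hW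
  -- A Lipschitz field on all of space-time lets integral curves exist without first knowing that
  -- they remain in `D`; that they do is shown afterwards.
  obtain ⟨F, hF, hFUW⟩ := (hK₁.prodMk hK₂).extend_finite_dimension
  generalize lipschitzExtensionConstant (Horiz d × ℝ) * max K₁ K₂ = K at hF
  have hstrip : Convex ℝ (strip d) := convex_univ.prod (convex_Ioo 0 1)
  obtain ⟨L, hL⟩ := hφ₀.exists_norm_fderiv_le hs isOpen_strip
  have hφ₀L := lipschitzOnWith_of_convex hstrip hL
  have hsubset : spaceTime (Ioo 0 T) (fluidDomain zb η) ⊆ spaceTime (Ioo 0 T) D := by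
    rcases hD with rfl | rfl
    · exact Subset.rfl
    · exact fun q hq => ⟨hq.1, mem_univ _⟩
  have hUW : ∀ q ∈ spaceTime (Ioo 0 T) D, F q = (joint U q, joint W q) := fun q hq => (hFUW hq).symm
  have hFu : ∀ q ∈ spaceTime (Ioo 0 T) (fluidDomain zb η), F q = (joint u q, joint w q) :=
    fun q hq => by rw [hUW q (hsubset hq), hUu hq, hWw hq]
  have hopen : ∀ T' ≤ T, IsOpen (spaceTime (Ioo 0 T') D) := fun T' hT' => by
    rcases hD with rfl | rfl
    · exact isOpen_spaceTime_fluidDomain hzbc hηc hT hT'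
    · have hset : spaceTime (Ioo 0 T') (fun _ => (univ : Set (Horiz d × ℝ))) =
          Prod.fst ⁻¹' Ioo 0 T' := by ext; simp [spaceTime]
      rw [hset]
      exact isOpen_Ioo.preimage continuous_fst
  have hFs : LocBddContDiffOn s F (spaceTime (Ioo 0 T) D) :=
    (hU.locBddContDiffOn.prodMk (hopen T le_rfl) hW.locBddContDiffOn).congr hUW
  obtain ⟨T', hT'0, hT'T, hKT⟩ : ∃ T' : ℝ, 0 < T' ∧ T' ≤ T ∧ 2 * K * T' * (1 + L) ≤ 1 / 2 := by
    have hc : (0 : ℝ) ≤ K * (1 + L) := by positivity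
    -- The summand `1` keeps the denominator positive when `K = 0`.
    refine ⟨min T (1 / (4 * (K * (1 + L) + 1))), by positivity, min_le_left _ _, ?_⟩
    calc _ = 2 * (K * (1 + L)) * min T (1 / (4 * (K * (1 + L) + 1))) := by ring
      _ ≤ 2 * (K * (1 + L)) * (1 / (4 * (K * (1 + L) + 1))) := by
          gcongr; exact min_le_right _ _
      _ ≤ 1 / 2 := by
          rw [mul_one_div, div_le_div_iff₀ (by positivity) (by norm_num)]
          linarith
  have hmem := fun α hα t ht => IsTrajectory.mem_fluidDomain_iff (α := α) (t := t) hs hsol hzb hη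
    hdepth hF hFu hT'T hα ht
  have hsub' : spaceTime (Ioo 0 T') D ⊆ spaceTime (Ioo 0 T) D := fun q hq =>
    ⟨⟨hq.1.1, hq.1.2.trans_le hT'T⟩, hq.2⟩
  have hUW' : ∀ q ∈ spaceTime (Ioo 0 T') D, F q = (joint U q, joint W q) :=
    fun q hq => hUW q (hsub' hq)
  obtain ⟨φ, hφ, hcar⟩ := exists_isCarried hT'0 hF hφ₀L hKT hs hφ₀.1 hφ₀D
    (by
      rcases hD with rfl | rfl
      · exact isOpen_extended_fluidDomain hzbc hηc hT hT'T
      · simpa using isOpen_lt continuous_fst continuous_const)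
    (hFs.mono_set (hopen T le_rfl) (hopen T' hT'T) hsub')
    (fun α hα h0 t ht => by
      rcases hD with rfl | rfl
      · exact (hmem α hα t ht).1 h0
      · exact mem_univ _) hUW'
  have hKT' : K * T' ≤ 1 / 2 := by
    have h1 : (0 : ℝ) ≤ K * T' := by positivity
    have h2 : (0 : ℝ) ≤ K * T' * L := by positivity
    nlinarith
  refine ⟨T', hT'0, hT'T, φ, hφ, fun ψ hψ t ht x l hl =>
    hψ.eq_of_isCarried hs hcar hF hKT' hUW' ht x hl, ?_⟩
  rintro ⟨ε, hε, hφ₀ε⟩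
  have hφ₀d : ∀ x, DifferentiableOn ℝ (φ₀ x) (Ioo 0 1) := fun x l hl =>
    ((hL (x, l) ⟨mem_univ _, hl⟩).1.comp (f := fun l => (x, l)) l
      (by fun_prop)).differentiableWithinAt
  have hinc₀ : ∀ x, ∀ l ∈ Ioo (0 : ℝ) 1, ∀ l' ∈ Ioo (0 : ℝ) 1, l < l' →
      ε * (l' - l) ≤ φ₀ x l' - φ₀ x l := fun x l hl l' hl' h =>
    increment_ge_of_deriv_ge (hφ₀d x) (hφ₀ε x) hl hl' h
  have hinc : ∀ t ∈ Ioo 0 T', ∀ x, ∀ l ∈ Ioo (0 : ℝ) 1, ∀ l' ∈ Ioo (0 : ℝ) 1, l < l' →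
      ε / 2 * (l' - l) ≤ φ t x l' - φ t x l := fun t ht x l hl l' hl' h =>
    hcar.increment_ge hF hφ₀L hKT hε hinc₀ (Ioo_subset_Ico_self ht) x hl hl' h
  refine ⟨fun t ht x l hl => ?_, fun hlim t ht => ?_⟩
  · have h := deriv_joint_right (hφ.differentiableAt hs ht x hl)
    rw [h.deriv]
    exact deriv_pos_of_increment_ge (half_pos hε) (hinc t ht x) hl h
  · have htI : t ∈ Ico 0 T' := Ioo_subset_Ico_self ht
    refine isOrientedDiffeoOn_of_increment_ge hs (half_pos hε) ?_ (hinc t ht) ?_ ?_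
    · exact hφ.contDiffOn.comp (f := fun p : Horiz d × ℝ => (t, p)) (by fun_prop)
        fun p hp => ⟨ht, hp⟩
    · intro x l hl
      obtain ⟨α, x₀, hα, hα0, hαt⟩ := hcar.exists_trajectory t htI x l hl
      -- Membership in `Ω_t` is tested at time `0`, where strict monotonicity places `φ₀ x₀ l`
      -- between its limits `zb x₀` and `η₀ x₀`. In case (b) the domain `D` alone would not give
      -- this.
      rw [← hαt, ← hmem α hα t htI, hα0]
      have hmono : StrictMonoOn (φ₀ x₀) (Ioo 0 1) := fun l hl l' hl' h => by
        have h1 := hinc₀ x₀ l hl l' hl' h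
        have h2 := mul_pos hε (sub_pos.2 h)
        linarith
      have h := mem_Ioo_of_strictMonoOn_of_tendsto hmono (hlim x₀).1 (hlim x₀).2 hl
      rw [← hsol.initial_η x₀] at h
      exact h
    · rintro ⟨y, z⟩ hyz
      -- Surjectivity: the curve through `(y, z)` starts in `Ω_0`, where the intermediate value
      -- theorem supplies a label `l`, and `φ` is carried along the curve with this label.
      obtain ⟨α, hα, hαt⟩ := exists_isTrajectory hF hKT' (Ioo_subset_Icc_self ht) (y, z)
      have h0 := (hmem α hα t htI).2 (by rwa [hαt])
      obtain ⟨l, hl, hlz⟩ := exists_mem_Ioo_eq_of_tendsto (hφ₀d (α 0).1).continuousOn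
        (hlim (α 0).1).1 (hlim (α 0).1).2 h0.1 (by rw [← hsol.initial_η]; exact h0.2)
      refine ⟨l, hl, ?_⟩
      have := hcar.apply_trajectory α hα (α 0).1 l hl (by rw [hlz]) t htI
      rwa [hαt] at this
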